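/- Let $F$ be an operator space, that is, a complex normed space with norms $\|\cdot\|_{M_n(F)}$ on the spaces $M_n(F)$, $n\ge 1$, satisfying Ruan's axioms and giving the norm of $F$ for $n=1$. Equip $F^*$ with its dual operator space structure $M_n(F^*)=CB(F,M_n)$, and let $F^{*\mathrm{op}}$ be the opposite operator space of $F^*$: $\|[\eta_{ij}]\|_{M_n(F^{*\mathrm{op}})}=\|[\eta_{ji}]\|_{M_n(F^*)}$. For a scalar matrix $a\in M_k$, let $\|a\|_p=(\mathrm{tr}\,|a|^p)^{1/p}$ be its Schatten norm and $\|a\|_\infty$ its operator norm. For an operator space $G$, $k\in\mathbb N$ and $1<p<\infty$, let $S^p_k\{G\}_\ell$ and $S^p_k\{G\}_r$ be the completions of $M_k\otimes G=M_k(G)$ for the following norms. If $p\ge 2$, put $$\|y\|_{S^p_k\{G\}_\ell}=\inf\|c\|_\infty\|z\|_{M_k(G)}\|d\|_p,\qquad \|y\|_{S^p_k\{G\}_r}=\inf\|c\|_p\|z\|_{M_k(G)}\|d\|_\infty ,$$ the infima running over all $c,d\in M_k$ and $z\in M_k(G)$ with $y=czd$. If $p\le 2$ and $\frac1q=\frac1p-\frac12$,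 put $$\|y\|_{S^p_k\{G\}_\ell}=\inf\|a\|_q\|z\|_{M_k(G)}\|b\|_2,\qquad \|y\|_{S^p_k\{G\}_r}=\inf\|a\|_2\|z\|_{M_k(G)}\|b\|_q ,$$ the infima running over all $a,b\in M_k$ and $z\in M_k(G)$ with $y=azb$. (For $p=2$, where $q=\infty$, the two definitions agree.) Let $1<p,p'<\infty$ with $\frac1p+\frac1{p'}=1$. Then the four expressions defining $S^p_k\{F\}_\ell$, $S^p_k\{F\}_r$, $S^{p'}_k\{F^{*\mathrm{op}}\}_\ell$ and $S^{p'}_k\{F^{*\mathrm{op}}\}_r$ are norms, and there are surjective linear isometries $$S^{p'}_k\{F^{*\mathrm{op}}\}_\ell\;\simeq\;\bigl(S^p_k\{F\}_\ell\bigr)^*\qquad\text{and}\qquad S^{p'}_k\{F^{*\mathrm{op}}\}_r\;\simeq\;\bigl(S^p_k\{F\}_r\bigr)^*,$$ each given by the duality pairing $\langle c\otimes\eta,\,a\otimes x\rangle=\mathrm{tr}(ac)\,\langle\eta,x\rangle$ for $a,c\in M_k$, $x\in F$, $\eta\in F^*$. -/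

import Mathlib

noncomputable section

namespace OpSp

open scoped Matrix.Norms.L2Operator

/-! ### Scalar and vector-valued matrices

Scalar matrices carry the operator norm between Euclidean spaces. -/

/-- The product `a x b` of a scalar matrix `a`, a matrix `x` over a vector space `F`, and a scalar
matrix `b`. -/
def biMul {F : Type*} [AddCommGroup F] [Module ℂ F] {l m n o : Type*} [Fintype m] [Fintype n]
    (a : Matrix l m ℂ) (x : Matrix m n F) (b : Matrix n o ℂ) : Matrix l o F :=
  Matrix.of fun i j => ∑ s, ∑ t, (a i s * b t j) • x s t

/-- The elementary tensor `a ⊗ x ∈ M_k ⊗ F`, seen in `M_k(F)`. -/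
def tmul {F : Type*} [AddCommGroup F] [Module ℂ F] {k : ℕ}
    (a : Matrix (Fin k) (Fin k) ℂ) (x : F) : Matrix (Fin k) (Fin k) F :=
  Matrix.of fun i j => a i j • x

/-- The block diagonal matrix `x ⊕ y`. -/
def dirSum {F : Type*} [AddCommGroup F] {m n : ℕ} (x : Matrix (Fin m) (Fin m) F)
    (y : Matrix (Fin n) (Fin n) F) : Matrix (Fin (m + n)) (Fin (m + n)) F :=
  (Matrix.fromBlocks x 0 0 y).submatrix finSumFinEquiv.symm finSumFinEquiv.symm

/-- An operator space structure on a normed space `F` (Ruan's axioms): a norm on each `M_n(F)`,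
which for `n = 1` is the given norm of `F`, satisfying
`‖x ⊕ y‖ = max ‖x‖ ‖y‖` and `‖a x b‖ ≤ ‖a‖ ‖x‖ ‖b‖` for scalar matrices `a`, `b`. -/
structure OperatorSpace (F : Type*) [NormedAddCommGroup F] [NormedSpace ℂ F] where
  matNorm : ∀ n : ℕ, Matrix (Fin n) (Fin n) F → ℝ
  matNorm_add_le : ∀ (n : ℕ) (x y : Matrix (Fin n) (Fin n) F),
    matNorm n (x + y) ≤ matNorm n x + matNorm n y
  matNorm_smul : ∀ (n : ℕ) (t : ℂ) (x : Matrix (Fin n) (Fin n) F),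
    matNorm n (t • x) = ‖t‖ * matNorm n x
  eq_zero_of_matNorm : ∀ (n : ℕ) (x : Matrix (Fin n) (Fin n) F), matNorm n x = 0 → x = 0
  matNorm_one : ∀ x : F, matNorm 1 (Matrix.of fun _ _ => x) = ‖x‖
  matNorm_dirSum : ∀ (m n : ℕ) (x : Matrix (Fin m) (Fin m) F) (y : Matrix (Fin n) (Fin n) F),
    matNorm (m + n) (dirSum x y) = max (matNorm m x) (matNorm n y)
  matNorm_biMul_le : ∀ (m n : ℕ) (a : Matrix (Fin m) (Fin n) ℂ) (x : Matrix (Fin n) (Fin n) F)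
    (b : Matrix (Fin n) (Fin m) ℂ), matNorm m (biMul a x b) ≤ ‖a‖ * matNorm n x * ‖b‖

/-! ### Auxiliary facts on the operator norm of scalar matrices -/

section aux

variable {m n l o : Type*} [Fintype m] [Fintype n] [Fintype l] [Fintype o]
  [DecidableEq n] [DecidableEq l] [DecidableEq o]

theorem sq_le_of_norm (A : Matrix m n ℂ) (v : n → ℂ) :
    ∑ i, ‖(A.mulVec v) i‖ ^ 2 ≤ ‖A‖ ^ 2 * ∑ j, ‖v j‖ ^ 2 := by
  have h := A.l2_opNorm_mulVec (WithLp.toLp 2 v)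
  have h2 := pow_le_pow_left₀ (norm_nonneg _) h 2
  rw [mul_pow, EuclideanSpace.norm_sq_eq, EuclideanSpace.norm_sq_eq] at h2
  simpa using h2

theorem norm_le_of_sq (A : Matrix m n ℂ) {C : ℝ} (hC : 0 ≤ C)
    (h : ∀ v : n → ℂ, ∑ i, ‖(A.mulVec v) i‖ ^ 2 ≤ C ^ 2 * ∑ j, ‖v j‖ ^ 2) : ‖A‖ ≤ C := by
  rw [Matrix.l2_opNorm_def]
  refine ContinuousLinearMap.opNorm_le_bound _ hC fun v => ?_
  refine le_of_sq_le_sq ?_ (by positivity)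
  rw [mul_pow, EuclideanSpace.norm_sq_eq, EuclideanSpace.norm_sq_eq]
  simpa using h v.ofLp

variable [DecidableEq m]

theorem norm_submatrix_le (A : Matrix m n ℂ) (e : l ≃ m) (f : o ≃ n) :
    ‖A.submatrix e f‖ ≤ ‖A‖ := by
  refine norm_le_of_sq _ (norm_nonneg _) fun v => ?_
  have h := sq_le_of_norm A (v ∘ f.symm)
  rw [← e.sum_comp, ← f.sum_comp] at h
  simpa [Matrix.submatrix_mulVec_equiv] using h

theorem norm_fromBlocks_le (A : Matrix m m ℂ) (B : Matrix n n ℂ) :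
    ‖Matrix.fromBlocks A 0 0 B‖ ≤ max ‖A‖ ‖B‖ := by
  refine norm_le_of_sq _ (by positivity) fun v => ?_
  have h1 := sq_le_of_norm A (v ∘ Sum.inl)
  have h2 := sq_le_of_norm B (v ∘ Sum.inr)
  have h3 : ‖A‖ ^ 2 ≤ (max ‖A‖ ‖B‖) ^ 2 := by gcongr; exact le_max_left _ _
  have h4 : ‖B‖ ^ 2 ≤ (max ‖A‖ ‖B‖) ^ 2 := by gcongr; exact le_max_right _ _
  simp only [Fintype.sum_sum_type, Matrix.fromBlocks_mulVec, Matrix.zero_mulVec, Sum.elim_inl,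
    Sum.elim_inr, add_zero, zero_add, mul_add]
  refine add_le_add (h1.trans ?_) (h2.trans ?_)
  · exact mul_le_mul_of_nonneg_right h3 (Finset.sum_nonneg fun _ _ => by positivity)
  · exact mul_le_mul_of_nonneg_right h4 (Finset.sum_nonneg fun _ _ => by positivity)

theorem norm_kronecker_one_le (A : Matrix m n ℂ) :
    ‖Matrix.kronecker A (1 : Matrix l l ℂ)‖ ≤ ‖A‖ := by
  refine norm_le_of_sq _ (norm_nonneg _) fun v => ?_
  rw [Fintype.sum_prod_type_right, Fintype.sum_prod_type_right, Finset.mul_sum]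
  refine Finset.sum_le_sum fun j _ => ?_
  refine le_of_eq_of_le ?_ (sq_le_of_norm A fun s => v (s, j))
  refine Finset.sum_congr rfl fun i _ => ?_
  congr 2
  simp [Matrix.mulVec, dotProduct, Fintype.sum_prod_type, Matrix.one_apply]

theorem norm_transpose_le (A : Matrix m n ℂ) : ‖A.transpose‖ ≤ ‖A‖ := by
  rw [← Matrix.l2_opNorm_conjTranspose A]
  refine norm_le_of_sq _ (norm_nonneg _) fun v => ?_
  refine le_of_eq_of_le ?_ ((sq_le_of_norm A.conjTranspose (star v)).trans_eq ?_)
  · refine Finset.sum_congr rfl fun i _ => ?_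
    rw [← norm_star]
    congr 2
    simp [Matrix.mulVec, dotProduct]
  · simp

theorem norm_col_le (v : m → ℂ) :
    ‖(Matrix.of fun i (_ : Fin 1) => v i)‖ ≤ Real.sqrt (∑ i, ‖v i‖ ^ 2) := by
  refine norm_le_of_sq _ (by positivity) fun w => ?_
  rw [Real.sq_sqrt (Finset.sum_nonneg fun _ _ => by positivity)]
  simp [Matrix.mulVec, dotProduct, mul_pow, Finset.sum_mul]

theorem norm_entry_le (A : Matrix m n ℂ) (i : m) (j : n) : ‖A i j‖ ≤ ‖A‖ := by
  have h := sq_le_of_norm A (Pi.single j 1)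
  have h1 : ∑ s, ‖(Pi.single j 1 : n → ℂ) s‖ ^ 2 = 1 := by
    rw [Finset.sum_eq_single j] <;> simp +contextual
  have h2 : ‖(A.mulVec (Pi.single j 1)) i‖ ^ 2 ≤ ∑ s, ‖(A.mulVec (Pi.single j 1)) s‖ ^ 2 :=
    Finset.single_le_sum (f := fun s => ‖(A.mulVec (Pi.single j 1)) s‖ ^ 2)
      (fun _ _ => by positivity) (Finset.mem_univ i)
  rw [h1, mul_one] at h
  simp only [Matrix.mulVec_single_one, Matrix.col_apply] at h h2
  exact le_of_sq_le_sq (h2.trans h) (norm_nonneg _)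

end aux

namespace OperatorSpace

variable {F : Type*} [NormedAddCommGroup F] [NormedSpace ℂ F] (S : OperatorSpace F)

theorem matNorm_zero (n : ℕ) : S.matNorm n 0 = 0 := by
  have := S.matNorm_smul n 0 0
  simpa using this

theorem matNorm_nonneg (n : ℕ) (x : Matrix (Fin n) (Fin n) F) : 0 ≤ S.matNorm n x := by
  have h := S.matNorm_add_le n x ((-1 : ℂ) • x)
  rw [S.matNorm_smul] at h
  simp [S.matNorm_zero] at h
  exact h

/-- Bounded functionals are completely bounded, with the same norm. -/
theorem norm_map_le (η : StrongDual ℂ F) (n : ℕ) (x : Matrix (Fin n) (Fin n) F) :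
    ‖x.map η‖ ≤ ‖η‖ * S.matNorm n x := by
  have hN := S.matNorm_nonneg n x
  refine norm_le_of_sq _ (by positivity) fun v => ?_
  set u := (x.map η).mulVec v with hu
  set U := Real.sqrt (∑ i, ‖u i‖ ^ 2) with hU
  set V := Real.sqrt (∑ i, ‖v i‖ ^ 2) with hV
  have hU2 : U ^ 2 = ∑ i, ‖u i‖ ^ 2 := Real.sq_sqrt (Finset.sum_nonneg fun _ _ => by positivity)
  have hV2 : V ^ 2 = ∑ i, ‖v i‖ ^ 2 := Real.sq_sqrt (Finset.sum_nonneg fun _ _ => by positivity)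
  let a : Matrix (Fin 1) (Fin n) ℂ := Matrix.of fun _ i => star (u i)
  let b : Matrix (Fin n) (Fin 1) ℂ := Matrix.of fun i _ => v i
  have ha : ‖a‖ ≤ U := by
    rw [← Matrix.l2_opNorm_conjTranspose]
    convert norm_col_le u using 2
    ext i j
    simp [a]
  have hb : ‖b‖ ≤ V := norm_col_le v
  set z : F := ∑ s, ∑ t, (star (u s) * v t) • x s t with hz
  have h1 : ‖z‖ ≤ U * S.matNorm n x * V := by
    rw [← S.matNorm_one z]
    refine (S.matNorm_biMul_le 1 n a x b).trans ?_
    gcongr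
  have h2 : η z = ((U ^ 2 : ℝ) : ℂ) := by
    rw [hU2, hz]
    simp only [map_sum, map_smul, smul_eq_mul]
    push_cast
    refine Finset.sum_congr rfl fun s _ => ?_
    rw [← Complex.conj_mul', hu]
    simp only [Matrix.mulVec, dotProduct, Finset.mul_sum, Matrix.map_apply]
    refine Finset.sum_congr rfl fun t _ => ?_
    simp only [starRingEnd_apply]
    ring
  have h3 : U ^ 2 ≤ ‖η‖ * (U * S.matNorm n x * V) := by
    have h4 := η.le_opNorm z
    rw [h2, Complex.norm_real, Real.norm_of_nonneg (by positivity)] at h4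
    exact h4.trans (by gcongr)
  rw [← hU2, ← hV2, ← mul_pow]
  have hU0 : 0 ≤ U := Real.sqrt_nonneg _
  have hV0 : 0 ≤ V := Real.sqrt_nonneg _
  rcases hU0.eq_or_lt with h0 | h0
  · rw [← h0, zero_pow two_ne_zero]; exact sq_nonneg _
  · refine pow_le_pow_left₀ hU0 ?_ 2
    have : U * U ≤ U * (‖η‖ * S.matNorm n x * V) := by nlinarith
    exact le_of_mul_le_mul_left this h0

/-! ### The opposite operator space -/

/-- The opposite operator space: the norm of `[x_ij]` is that of `[x_ji]`. -/
def op : OperatorSpace F where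
  matNorm n x := S.matNorm n x.transpose
  matNorm_add_le n x y := by simpa using S.matNorm_add_le n x.transpose y.transpose
  matNorm_smul n t x := by simpa using S.matNorm_smul n t x.transpose
  eq_zero_of_matNorm n x h := by simpa using S.eq_zero_of_matNorm n _ h
  matNorm_one x := S.matNorm_one x
  matNorm_dirSum m n x y := by
    rw [← S.matNorm_dirSum]
    simp [dirSum, Matrix.transpose_submatrix, Matrix.fromBlocks_transpose]
  matNorm_biMul_le m n a x b := by
    have h : (biMul a x b).transpose = biMul b.transpose x.transpose a.transpose := by
      ext i j
      simp only [biMul, Matrix.transpose_apply, Matrix.of_apply]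
      rw [Finset.sum_comm]
      simp only [mul_comm]
    rw [h]
    refine (S.matNorm_biMul_le m n _ _ _).trans ?_
    have hN := S.matNorm_nonneg n x.transpose
    have ha := norm_transpose_le a
    have hb := norm_transpose_le b
    calc ‖b.transpose‖ * S.matNorm n x.transpose * ‖a.transpose‖
        ≤ ‖b‖ * S.matNorm n x.transpose * ‖a‖ := by gcongr
      _ = ‖a‖ * S.matNorm n x.transpose * ‖b‖ := by ring

/-! ### The dual operator space -/

/-- The scalar matrix `[η_ij(x_kl)]`, with rows indexed by the pairs `(i, k)` and columns indexed
by the pairs `(j, l)`. -/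
def amplify {F : Type*} [NormedAddCommGroup F] [NormedSpace ℂ F] {n m : ℕ}
    (η : Matrix (Fin n) (Fin n) (StrongDual ℂ F)) (x : Matrix (Fin m) (Fin m) F) :
    Matrix (Fin n × Fin m) (Fin n × Fin m) ℂ :=
  Matrix.of fun a b => η a.1 b.1 (x a.2 b.2)

/-- The completely bounded norm of the map `F → M_n`, `x ↦ [η_ij(x)]`. -/
def dualMatNorm (n : ℕ) (η : Matrix (Fin n) (Fin n) (StrongDual ℂ F)) : ℝ :=
  sSup {r | ∃ (m : ℕ) (x : Matrix (Fin m) (Fin m) F), S.matNorm m x ≤ 1 ∧ r = ‖amplify η x‖}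

theorem norm_single_kronecker_le {n m : ℕ} (i j : Fin n) (B : Matrix (Fin m) (Fin m) ℂ) :
    ‖(Matrix.of fun a b : Fin n × Fin m => if a.1 = i ∧ b.1 = j then B a.2 b.2 else 0)‖
      ≤ ‖B‖ := by
  refine norm_le_of_sq _ (norm_nonneg _) fun v => ?_
  have h := sq_le_of_norm B fun t => v (j, t)
  calc _ = ∑ s, ‖(B.mulVec fun t => v (j, t)) s‖ ^ 2 := by
        rw [Fintype.sum_prod_type, Finset.sum_eq_single i]
        · refine Finset.sum_congr rfl fun s _ => ?_
          congr 2
          simp [Matrix.mulVec, dotProduct, Fintype.sum_prod_type]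
        · intro i' _ hi'
          simp [Matrix.mulVec, dotProduct, hi']
        · simp
    _ ≤ _ := h
    _ ≤ _ := by
        gcongr
        rw [Fintype.sum_prod_type]
        exact Finset.single_le_sum (f := fun i => ∑ t, ‖v (i, t)‖ ^ 2)
          (fun _ _ => Finset.sum_nonneg fun _ _ => by positivity) (Finset.mem_univ j)

theorem norm_amplify_le_sum {n m : ℕ} (η : Matrix (Fin n) (Fin n) (StrongDual ℂ F))
    (x : Matrix (Fin m) (Fin m) F) :
    ‖amplify η x‖ ≤ (∑ i, ∑ j, ‖η i j‖) * S.matNorm m x := by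
  have h : amplify η x = ∑ i, ∑ j, (Matrix.of fun a b : Fin n × Fin m =>
      if a.1 = i ∧ b.1 = j then (x.map (η i j)) a.2 b.2 else 0) := by
    ext a b
    simp only [Matrix.sum_apply, Matrix.of_apply, amplify, Matrix.map_apply]
    rw [Finset.sum_eq_single a.1, Finset.sum_eq_single b.1] <;> simp +contextual [eq_comm]
  rw [h, Finset.sum_mul]
  refine (norm_sum_le _ _).trans (Finset.sum_le_sum fun i _ => ?_)
  rw [Finset.sum_mul]
  refine (norm_sum_le _ _).trans (Finset.sum_le_sum fun j _ => ?_)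
  exact (norm_single_kronecker_le i j _).trans (S.norm_map_le _ _ _)

theorem dual_bddAbove (n : ℕ) (η : Matrix (Fin n) (Fin n) (StrongDual ℂ F)) :
    BddAbove {r | ∃ (m : ℕ) (x : Matrix (Fin m) (Fin m) F),
      S.matNorm m x ≤ 1 ∧ r = ‖amplify η x‖} := by
  refine ⟨∑ i, ∑ j, ‖η i j‖, ?_⟩
  rintro r ⟨m, x, hx, rfl⟩
  refine (S.norm_amplify_le_sum η x).trans (mul_le_of_le_one_right ?_ hx)
  exact Finset.sum_nonneg fun _ _ => Finset.sum_nonneg fun _ _ => norm_nonneg _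

theorem norm_amplify_le_of_le_one {n m : ℕ} (η : Matrix (Fin n) (Fin n) (StrongDual ℂ F))
    (x : Matrix (Fin m) (Fin m) F) (hx : S.matNorm m x ≤ 1) :
    ‖amplify η x‖ ≤ S.dualMatNorm n η :=
  le_csSup (S.dual_bddAbove n η) ⟨m, x, hx, rfl⟩

theorem dualMatNorm_le {n : ℕ} {η : Matrix (Fin n) (Fin n) (StrongDual ℂ F)} {C : ℝ}
    (h : ∀ (m : ℕ) (x : Matrix (Fin m) (Fin m) F), S.matNorm m x ≤ 1 → ‖amplify η x‖ ≤ C) :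
    S.dualMatNorm n η ≤ C := by
  refine csSup_le ⟨_, 0, 0, ?_, rfl⟩ ?_
  · rw [S.matNorm_zero]; exact zero_le_one
  · rintro r ⟨m, x, hx, rfl⟩
    exact h m x hx

theorem dualMatNorm_nonneg (n : ℕ) (η : Matrix (Fin n) (Fin n) (StrongDual ℂ F)) :
    0 ≤ S.dualMatNorm n η :=
  (norm_nonneg _).trans (S.norm_amplify_le_of_le_one η (0 : Matrix (Fin 0) (Fin 0) F)
    (by rw [S.matNorm_zero]; exact zero_le_one))

theorem norm_entry_le_dualMatNorm (n : ℕ) (η : Matrix (Fin n) (Fin n) (StrongDual ℂ F))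
    (i j : Fin n) : ‖η i j‖ ≤ S.dualMatNorm n η := by
  refine ContinuousLinearMap.opNorm_le_of_unit_norm (𝕜 := ℂ) (S.dualMatNorm_nonneg n η) ?_
  intro x hx
  have h := S.norm_amplify_le_of_le_one η (Matrix.of fun _ _ : Fin 1 => x)
    (by rw [S.matNorm_one, hx])
  refine le_trans ?_ h
  exact norm_entry_le (amplify η (Matrix.of fun _ _ : Fin 1 => x)) (i, 0) (j, 0)

theorem dualMatNorm_biMul_le (m n : ℕ) (a : Matrix (Fin m) (Fin n) ℂ)
    (η : Matrix (Fin n) (Fin n) (StrongDual ℂ F)) (b : Matrix (Fin n) (Fin m) ℂ) :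
    S.dualMatNorm m (biMul a η b) ≤ ‖a‖ * S.dualMatNorm n η * ‖b‖ := by
  refine S.dualMatNorm_le fun r x hx => ?_
  have h : amplify (biMul a η b) x = Matrix.kronecker a (1 : Matrix (Fin r) (Fin r) ℂ) *
      amplify η x * Matrix.kronecker b (1 : Matrix (Fin r) (Fin r) ℂ) := by
    ext i j
    simp only [amplify, biMul, Matrix.of_apply, Matrix.mul_apply, Fintype.sum_prod_type,
      Matrix.kronecker, Matrix.kroneckerMap_apply, Matrix.one_apply, mul_ite, mul_one, mul_zero,
      ite_mul, zero_mul, Finset.sum_ite_eq, Finset.sum_ite_eq', Finset.mem_univ, if_true,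
      sum_apply, smul_apply, smul_eq_mul, Finset.sum_mul]
    rw [Finset.sum_comm]
    refine Finset.sum_congr rfl fun t _ => Finset.sum_congr rfl fun s _ => ?_
    ring
  rw [h]
  have hN := S.dualMatNorm_nonneg n η
  refine (Matrix.l2_opNorm_mul _ _).trans (mul_le_mul ((Matrix.l2_opNorm_mul _ _).trans
    (mul_le_mul (norm_kronecker_one_le a) (S.norm_amplify_le_of_le_one η x hx)
      (norm_nonneg _) (norm_nonneg _))) (norm_kronecker_one_le b) (norm_nonneg _) (by positivity))

/-- The corner embeddings are contractive. -/
theorem norm_incl_le {m n : Type*} [Fintype m] [Fintype n] [DecidableEq m] [DecidableEq n]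
    (f : m → n) (hf : Function.Injective f) :
    ‖(Matrix.of fun i j => if f i = j then (1 : ℂ) else 0 : Matrix m n ℂ)‖ ≤ 1 := by
  refine norm_le_of_sq _ zero_le_one fun v => ?_
  simp only [Matrix.mulVec, dotProduct, Matrix.of_apply, ite_mul, one_mul, zero_mul,
    Finset.sum_ite_eq, Finset.mem_univ, if_true, one_pow]
  refine le_of_eq_of_le (Finset.sum_map Finset.univ ⟨f, hf⟩ fun j => ‖v j‖ ^ 2).symm ?_
  exact Finset.sum_le_sum_of_subset_of_nonneg (Finset.subset_univ _) fun _ _ _ => by positivity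

theorem dualMatNorm_compress_le {m n : ℕ} (f : Fin m → Fin n) (hf : Function.Injective f)
    (η : Matrix (Fin n) (Fin n) (StrongDual ℂ F)) :
    S.dualMatNorm m (η.submatrix f f) ≤ S.dualMatNorm n η := by
  set a : Matrix (Fin m) (Fin n) ℂ := Matrix.of fun i j => if f i = j then (1 : ℂ) else 0 with ha
  have h1 : ‖a‖ ≤ 1 := norm_incl_le f hf
  have h2 : ‖a.transpose‖ ≤ 1 := (norm_transpose_le a).trans h1
  have h3 : η.submatrix f f = biMul a η a.transpose := by
    refine Matrix.ext fun i j => ?_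
    simp only [biMul, ha, Matrix.of_apply, Matrix.transpose_apply, Matrix.submatrix_apply]
    rw [Finset.sum_eq_single (f i), Finset.sum_eq_single (f j)]
    · rw [if_pos rfl, if_pos rfl, mul_one, one_smul]
    · intro t _ ht
      rw [if_neg (Ne.symm ht), mul_zero]
      exact zero_smul ℂ (η _ _)
    · simp
    · intro s _ hs
      refine Finset.sum_eq_zero fun t _ => ?_
      rw [if_neg (Ne.symm hs), zero_mul]
      exact zero_smul ℂ (η _ _)
    · simp
  rw [h3]
  have hN := S.dualMatNorm_nonneg n η
  calc _ ≤ ‖a‖ * S.dualMatNorm n η * ‖a.transpose‖ := S.dualMatNorm_biMul_le _ _ _ _ _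
    _ ≤ 1 * S.dualMatNorm n η * 1 := by gcongr
    _ = _ := by ring

/-- The dual operator space: the norm on `M_n(F*)` comes from the identification of `M_n(F*)` with
the completely bounded maps `F → M_n`. -/
def dual : OperatorSpace (StrongDual ℂ F) where
  matNorm := S.dualMatNorm
  matNorm_add_le n η ξ := by
    refine S.dualMatNorm_le fun m x hx => ?_
    have h : amplify (η + ξ) x = amplify η x + amplify ξ x := by
      ext a b; simp [amplify]
    rw [h]
    exact (norm_add_le _ _).trans (add_le_add (S.norm_amplify_le_of_le_one η x hx)
      (S.norm_amplify_le_of_le_one ξ x hx))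
  matNorm_smul n t η := by
    have key : ∀ (t : ℂ) (η : Matrix (Fin n) (Fin n) (StrongDual ℂ F)),
        S.dualMatNorm n (t • η) ≤ ‖t‖ * S.dualMatNorm n η := by
      intro t η
      refine S.dualMatNorm_le fun m x hx => ?_
      have h : amplify (t • η) x = t • amplify η x := by
        ext a b; simp [amplify]
      rw [h, norm_smul]
      gcongr
      exact S.norm_amplify_le_of_le_one η x hx
    refine le_antisymm (key t η) ?_
    rcases eq_or_ne t 0 with rfl | ht
    · rw [norm_zero, zero_mul]
      exact S.dualMatNorm_nonneg n _
    · have h := key t⁻¹ (t • η)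
      rw [smul_smul, inv_mul_cancel₀ ht, one_smul, norm_inv] at h
      have ht' : 0 < ‖t‖ := norm_pos_iff.mpr ht
      calc ‖t‖ * S.dualMatNorm n η ≤ ‖t‖ * (‖t‖⁻¹ * S.dualMatNorm n (t • η)) := by gcongr
        _ = _ := by field_simp
  eq_zero_of_matNorm n η h := by
    refine Matrix.ext fun i j => ?_
    have := S.norm_entry_le_dualMatNorm n η i j
    rw [h] at this
    simpa using this
  matNorm_one η := by
    refine le_antisymm (S.dualMatNorm_le fun m x hx => ?_) ?_
    · refine (S.norm_amplify_le_sum _ x).trans ?_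
      simpa using mul_le_of_le_one_right (norm_nonneg η) hx
    · exact S.norm_entry_le_dualMatNorm 1 (Matrix.of fun _ _ => η) 0 0
  matNorm_dirSum m n η ξ := by
    refine le_antisymm (S.dualMatNorm_le fun r x hx => ?_) (max_le ?_ ?_)
    · have h : amplify (dirSum η ξ) x =
          (Matrix.fromBlocks (amplify η x) 0 0 (amplify ξ x)).submatrix
            ((finSumFinEquiv.symm.prodCongr (Equiv.refl (Fin r))).trans
              (Equiv.sumProdDistrib _ _ _))
            ((finSumFinEquiv.symm.prodCongr (Equiv.refl (Fin r))).trans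
              (Equiv.sumProdDistrib _ _ _)) := by
        ext ⟨a, k⟩ ⟨b, l⟩
        obtain ⟨a, rfl⟩ := finSumFinEquiv.surjective a
        obtain ⟨b, rfl⟩ := finSumFinEquiv.surjective b
        rcases a with a | a <;> rcases b with b | b <;>
          simp [amplify, dirSum]
      rw [h]
      exact (norm_submatrix_le _ _ _).trans ((norm_fromBlocks_le _ _).trans
        (max_le_max (S.norm_amplify_le_of_le_one η x hx) (S.norm_amplify_le_of_le_one ξ x hx)))
    · have h : η = (dirSum η ξ).submatrix (Fin.castAdd n) (Fin.castAdd n) := by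
        refine Matrix.ext fun i j => ?_
        simp [dirSum]
      conv_lhs => rw [h]
      exact S.dualMatNorm_compress_le _ (Fin.castAdd_injective m n) _
    · have h : ξ = (dirSum η ξ).submatrix (Fin.natAdd m) (Fin.natAdd m) := by
        refine Matrix.ext fun i j => ?_
        simp [dirSum]
      conv_lhs => rw [h]
      exact S.dualMatNorm_compress_le _ (Fin.natAdd_injective n m) _
  matNorm_biMul_le := S.dualMatNorm_biMul_le

end OperatorSpace

/-! ### Schatten norms and the norms `α_p^ℓ`, `α_p^r` on `M_k ⊗ F = M_k(F)` -/

/-- The Schatten norm `‖a‖_p = (tr |a|^p)^{1/p}`, `0 < p < ∞`. The eigenvalues of `|a|` are the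
square roots of the eigenvalues of `a* a`. -/
def schattenNorm (p : ℝ) {k : ℕ} (a : Matrix (Fin k) (Fin k) ℂ) : ℝ :=
  (∑ i, Real.sqrt ((Matrix.isHermitian_conjTranspose_mul_self a).eigenvalues i) ^ p) ^ (1 / p)

namespace OperatorSpace

variable {F : Type*} [NormedAddCommGroup F] [NormedSpace ℂ F]

/-- The norm of `S^p_k{F}_ℓ`. If `p ≥ 2`, it is the infimum of `‖c‖_∞ ‖z‖_min ‖d‖_p` over all
factorizations `y = c z d`; if `p < 2`, it is the infimum of `‖a‖_q ‖z‖_min ‖b‖_2` over all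
factorizations `y = a z b`, where `1 / 2 + 1 / q = 1 / p`. At `p = 2` we have `q = ∞`, and both
descriptions agree. The norm of `M_k ⊗_min F` is that of `M_k(F)`. -/
def alphaL (S : OperatorSpace F) (p : ℝ) (k : ℕ) (y : Matrix (Fin k) (Fin k) F) : ℝ :=
  if 2 ≤ p then
    sInf {r | ∃ (c d : Matrix (Fin k) (Fin k) ℂ) (z : Matrix (Fin k) (Fin k) F),
      y = biMul c z d ∧ r = ‖c‖ * S.matNorm k z * schattenNorm p d}
  else
    sInf {r | ∃ (a b : Matrix (Fin k) (Fin k) ℂ) (z : Matrix (Fin k) (Fin k) F),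
      y = biMul a z b ∧ r = schattenNorm (1 / (1 / p - 1 / 2)) a * S.matNorm k z * schattenNorm 2 b}

/-- The norm of `S^p_k{F}_r`. If `p ≥ 2`, it is the infimum of `‖c‖_p ‖z‖_min ‖d‖_∞` over all
factorizations `y = c z d`; if `p < 2`, it is the infimum of `‖a‖_2 ‖z‖_min ‖b‖_q` over all
factorizations `y = a z b`, where `1 / 2 + 1 / q = 1 / p`. -/
def alphaR (S : OperatorSpace F) (p : ℝ) (k : ℕ) (y : Matrix (Fin k) (Fin k) F) : ℝ :=
  if 2 ≤ p then
    sInf {r | ∃ (c d : Matrix (Fin k) (Fin k) ℂ) (z : Matrix (Fin k) (Fin k) F),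
      y = biMul c z d ∧ r = schattenNorm p c * S.matNorm k z * ‖d‖}
  else
    sInf {r | ∃ (a b : Matrix (Fin k) (Fin k) ℂ) (z : Matrix (Fin k) (Fin k) F),
      y = biMul a z b ∧ r = schattenNorm 2 a * S.matNorm k z * schattenNorm (1 / (1 / p - 1 / 2)) b}

end OperatorSpace

/-! ### The Banach space obtained by completing a vector space for a norm -/

/-- `ν` is a norm on the complex vector space `E`. -/
structure IsNorm {E : Type*} [AddCommGroup E] [Module ℂ E] (ν : E → ℝ) : Prop where
  add_le : ∀ x y, ν (x + y) ≤ ν x + ν y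
  smul : ∀ (t : ℂ) x, ν (t • x) = ‖t‖ * ν x
  eq_zero : ∀ x, ν x = 0 → x = 0

section

variable {E : Type*} [AddCommGroup E] [Module ℂ E] {ν : E → ℝ}

/-- The vector space `E`, equipped with the norm `ν`. -/
def NormedBy (_ : IsNorm ν) : Type _ := E

instance (h : IsNorm ν) : AddCommGroup (NormedBy h) := inferInstanceAs (AddCommGroup E)

instance (h : IsNorm ν) : Module ℂ (NormedBy h) := inferInstanceAs (Module ℂ E)

instance (h : IsNorm ν) : NormedAddCommGroup (NormedBy h) :=
  AddGroupNorm.toNormedAddCommGroup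
    { toFun := (ν : E → ℝ)
      map_zero' := by
        have h0 := h.smul 0 (0 : E)
        rw [zero_smul, norm_zero, zero_mul] at h0
        exact h0
      add_le' := h.add_le
      neg' := fun (x : E) => by
        have h1 := h.smul (-1) x
        rw [neg_one_smul, norm_neg, norm_one, one_mul] at h1
        exact h1
      eq_zero_of_map_eq_zero' := h.eq_zero }

instance (h : IsNorm ν) : NormedSpace ℂ (NormedBy h) where
  norm_smul_le t x := (h.smul t x).le

theorem norm_normedBy (h : IsNorm ν) (x : E) : ‖(show NormedBy h from x)‖ = ν x := rfl

/-- The completion of `E` for the norm `ν`. -/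
abbrev BanachBy (h : IsNorm ν) : Type _ := UniformSpace.Completion (NormedBy h)

/-- The canonical map from `E` to its completion for the norm `ν`. -/
def BanachBy.of (h : IsNorm ν) (x : E) : BanachBy h :=
  ((show NormedBy h from x : NormedBy h) : UniformSpace.Completion (NormedBy h))

end

end OpSp

end

namespace OpSp

open scoped Matrix.Norms.L2Operator ComplexOrder
open Matrix

/-! All four expressions have one shape. Since `‖a‖_p² = N(a* a)`, where `N` is the `ℓ^{p/2}` norm
of the eigenvalues (the largest eigenvalue for `p = ∞`), each is an infimum `facNorm S N₁ N₂` of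
`N₁(c c*)^{1/2} ‖z‖ N₂(d* d)^{1/2}` over `y = c z d`. The gauges come in pairs dual for the trace
(`dualGauges_lp`, `dualGauges_norm_trace`), and `1/q = 1/p - 1/2` gives `2/q + 2/p' = 1`. So
everything reduces to one duality: the dual of `facNorm S N₁ N₂` is `facNorm S.dual.op N₂' N₁'`
(`exists_dual_isometry`).

Only `P = c c*` and `R = d* d` matter in a factorization, whose inner size may be arbitrary (`Fac`).
Direct sums of factorizations add `P`, `R` and `y`, and a factorization of any size can be
compressed to size `k` (`Fac.facNorm_le`). This gives the triangle inequality.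

Upper bound (`norm_pairing_le`): for `η = a ζ b` and `y = c z d`, cyclicity leaves `ζ` paired with
`(bc) z (da)`. This is the bilinear form of the contraction `[ζ_ji(z_st)]` at the vectors `bc` and
`da`, whose squared lengths are `tr(c c* b* b)` and `tr(d* d a a*)`; trace Hölder concludes.

Converse (`facNorm_dual_le_one`): if `η` has norm at most `1` as a functional, then `Re ⟨η, y⟩ ≤ (N₁
P + N₂ R) / 2` for every factorization. The right side is the maximum of `(tr(P f) + tr(R g)) / 2`
over the dual balls. As factorizations form a convex cone, minimax yields one pair `f`, `g` valid
for all of them. Then `η = A ζ B` with `A A*` and `B* B` close to `g` and `f`, and the domination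
says exactly that `ζ` is contractive. -/

/-! ### Minimax -/

/-- A form of the minimax theorem: if every nonnegative combination of a family of continuous affine
functions is somewhere nonnegative on a compact convex set, then all functions of the family are
nonnegative at a common point. -/
theorem exists_forall_nonneg_of_affine {V : Type*} [AddCommGroup V] [Module ℝ V]
    [TopologicalSpace V] {K : Set V} (hK : IsCompact K) (hKc : Convex ℝ K) {ι : Type*}
    (h : ι → V → ℝ) (hcont : ∀ i, Continuous (h i))
    (haff : ∀ i x y (a b : ℝ), a + b = 1 → h i (a • x + b • y) = a * h i x + b * h i y)
    (hpos : ∀ (s : Finset ι) (w : ι → ℝ), (∀ i, 0 ≤ w i) →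
      ∃ v ∈ K, 0 ≤ ∑ i ∈ s, w i * h i v) :
    ∃ v ∈ K, ∀ i, 0 ≤ h i v := by
  classical
  have key := hK.inter_iInter_nonempty (fun i => {v | 0 ≤ h i v})
    (fun i => isClosed_le continuous_const (hcont i)) ?_
  · obtain ⟨v, hv, hv'⟩ := key
    exact ⟨v, hv, fun i => Set.mem_iInter.1 hv' i⟩
  -- By compactness it is enough to treat a finite subfamily `u`, where the image of `K` in `ℝ^u`
  -- can be separated from the nonnegative orthant.
  intro u
  by_contra hne
  let H : V → (u → ℝ) := fun v i => h i v
  have hHc : Continuous H := continuous_pi fun i => hcont i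
  have hL : Convex ℝ (H '' K) := by
    rintro _ ⟨x, hx, rfl⟩ _ ⟨y, hy, rfl⟩ a b ha hb hab
    refine ⟨a • x + b • y, hKc hx hy ha hb hab, ?_⟩
    ext i
    simp [H, haff _ _ _ _ _ hab]
  have hO : Convex ℝ {x : u → ℝ | 0 ≤ x} := convex_Ici (𝕜 := ℝ) (0 : u → ℝ)
  have hOc : IsClosed {x : u → ℝ | 0 ≤ x} := isClosed_Ici
  have hdisj : Disjoint (H '' K) {x : u → ℝ | 0 ≤ x} := by
    rw [Set.disjoint_left]
    rintro _ ⟨x, hx, rfl⟩ hx'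
    refine hne ⟨x, hx, ?_⟩
    simp only [Set.mem_iInter, Set.mem_ofPred_eq]
    intro i hi
    exact hx' ⟨i, hi⟩
  obtain ⟨f, a, b, hfa, hab, hfb⟩ :=
    geometric_hahn_banach_compact_closed hL (hK.image hHc) hO hOc hdisj
  have hb0 : b < 0 := by simpa using hfb 0 (le_refl (0 : u → ℝ))
  have hw : ∀ i : u, 0 ≤ f (Pi.single i 1) := by
    intro i
    by_contra hlt
    push Not at hlt
    -- A negative coefficient would give a point of the orthant, on the `i`-th axis, where `f` takes
    -- exactly the value `b`, against the strict separation.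
    have h1 := hfb ((b / f (Pi.single i 1)) • Pi.single i 1) (by
      intro j
      have : 0 ≤ b / f (Pi.single i 1) := div_nonneg_of_nonpos hb0.le hlt.le
      simp only [Pi.zero_apply, Pi.smul_apply, smul_eq_mul]
      refine mul_nonneg this ?_
      by_cases hij : j = i
      · subst hij; simp
      · simp [hij])
    rw [map_smul, smul_eq_mul, div_mul_cancel₀ _ hlt.ne] at h1
    exact lt_irrefl _ h1
  -- The coefficients of the separating functional serve as weights, extended by `0` outside `u`.
  -- The weighted sum is then `f (H v)`, which is at once nonnegative and below `b < 0`.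
  obtain ⟨v, hvK, hv⟩ := hpos u (fun i => if hi : i ∈ u then f (Pi.single ⟨i, hi⟩ 1) else 0)
    (fun i => by
      by_cases hi : i ∈ u
      · simpa [hi] using hw ⟨i, hi⟩
      · simp [hi])
  have h2 : f (H v) = ∑ i ∈ u, (if hi : i ∈ u then f (Pi.single ⟨i, hi⟩ 1) else 0) * h i v := by
    rw [← Finset.sum_coe_sort u]
    conv_lhs => rw [← Finset.univ_sum_single (H v), map_sum]
    refine Finset.sum_congr rfl fun i _ => ?_
    have : (Pi.single i (H v i) : u → ℝ) = (h i v) • Pi.single i 1 := by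
      ext j
      by_cases hij : j = i
      · subst hij; simp [H]
      · simp [hij]
    rw [this, map_smul, smul_eq_mul, mul_comm, dif_pos i.2]
  have h3 := hfa _ ⟨v, hvK, rfl⟩
  rw [h2] at h3
  linarith

/-! ### Positive semidefinite matrices -/

section psd

variable {k : ℕ}

theorem exists_conjTranspose_mul_self_eq {P : Matrix (Fin k) (Fin k) ℂ} (hP : P.PosSemidef) :
    ∃ B : Matrix (Fin k) (Fin k) ℂ, Bᴴ * B = P := by
  open scoped MatrixOrder in
  obtain ⟨B, hB⟩ := CStarAlgebra.nonneg_iff_eq_star_mul_self.1 hP.nonneg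
  exact ⟨B, hB.symm⟩

theorem trace_conjTranspose_mul_self_re {m n : Type*} [Fintype m] [Fintype n] (B : Matrix m n ℂ) :
    (Bᴴ * B).trace.re = ∑ i, ∑ j, ‖B i j‖ ^ 2 := by
  rw [Finset.sum_comm]
  simp only [Matrix.trace, Matrix.diag, Matrix.mul_apply, conjTranspose_apply, Complex.re_sum]
  refine Finset.sum_congr rfl fun j _ => Finset.sum_congr rfl fun i _ => ?_
  rw [Complex.star_def, Complex.conj_mul', ← Complex.ofReal_pow, Complex.ofReal_re]

theorem trace_mul_re_nonneg {P Q : Matrix (Fin k) (Fin k) ℂ} (hP : P.PosSemidef)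
    (hQ : Q.PosSemidef) : 0 ≤ (P * Q).trace.re := by
  obtain ⟨B, rfl⟩ := exists_conjTranspose_mul_self_eq hP
  rw [Matrix.mul_assoc, Matrix.trace_mul_comm]
  exact (Complex.le_def.1 (hQ.mul_mul_conjTranspose_same B).trace_nonneg).1

/-- The spectral theorem, in terms of matrix products. -/
theorem eq_unitary_mul_diagonal_mul {P : Matrix (Fin k) (Fin k) ℂ} (hP : P.IsHermitian) :
    P = (hP.eigenvectorUnitary : Matrix (Fin k) (Fin k) ℂ) *
      diagonal (fun i => (hP.eigenvalues i : ℂ)) *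
      (hP.eigenvectorUnitary : Matrix (Fin k) (Fin k) ℂ)ᴴ := by
  conv_lhs => rw [hP.spectral_theorem, Unitary.conjStarAlgAut_apply]
  rfl

theorem norm_eq_norm_eigenvalues {P : Matrix (Fin k) (Fin k) ℂ} (hP : P.IsHermitian) :
    ‖P‖ = ‖hP.eigenvalues‖ := by
  conv_lhs => rw [hP.spectral_theorem, Unitary.conjStarAlgAut_apply,
    ← Unitary.coe_star, CStarRing.norm_mul_coe_unitary, CStarRing.norm_coe_unitary_mul,
    l2_opNorm_diagonal]
  simp [Pi.norm_def]

theorem trace_re_eq_sum_eigenvalues {P : Matrix (Fin k) (Fin k) ℂ} (hP : P.IsHermitian) :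
    P.trace.re = ∑ i, hP.eigenvalues i := by
  rw [hP.trace_eq_sum_eigenvalues]
  simp

theorem norm_le_trace_re {P : Matrix (Fin k) (Fin k) ℂ} (hP : P.PosSemidef) :
    ‖P‖ ≤ P.trace.re := by
  have h0 := fun i => hP.eigenvalues_nonneg i
  rw [norm_eq_norm_eigenvalues hP.isHermitian, trace_re_eq_sum_eigenvalues hP.isHermitian]
  refine (pi_norm_le_iff_of_nonneg (Finset.sum_nonneg fun i _ => h0 i)).2 fun i => ?_
  rw [Real.norm_of_nonneg (h0 i)]
  exact Finset.single_le_sum (f := hP.isHermitian.eigenvalues) (fun i _ => h0 i)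
    (Finset.mem_univ i)

theorem isClosed_posSemidef : IsClosed {P : Matrix (Fin k) (Fin k) ℂ | P.PosSemidef} := by
  open scoped MatrixOrder in
  have : {P : Matrix (Fin k) (Fin k) ℂ | P.PosSemidef} = Set.Ici 0 := by
    ext P
    exact Matrix.nonneg_iff_posSemidef.symm
  rw [this]
  exact CStarAlgebra.isClosed_nonneg

theorem posSemidef_real_smul {P : Matrix (Fin k) (Fin k) ℂ} (hP : P.PosSemidef) {t : ℝ}
    (ht : 0 ≤ t) : (t • P).PosSemidef :=
  hP.smul ht

end psd

/-! ### Dual pairs of gauges on positive semidefinite matrices -/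

/-- `N` and `N'` are norms on the cone of positive semidefinite matrices, dual to each other for the
trace pairing. -/
structure DualGauges {k : ℕ} (N N' : Matrix (Fin k) (Fin k) ℂ → ℝ) : Prop where
  holder : ∀ P Q, P.PosSemidef → Q.PosSemidef → (P * Q).trace.re ≤ N P * N' Q
  attain : ∀ P, P.PosSemidef → ∃ Q, Q.PosSemidef ∧ N' Q ≤ 1 ∧ (P * Q).trace.re = N P
  attain' : ∀ Q, Q.PosSemidef → ∃ P, P.PosSemidef ∧ N P ≤ 1 ∧ (Q * P).trace.re = N' Q

namespace DualGauges

variable {k : ℕ} {N N' : Matrix (Fin k) (Fin k) ℂ → ℝ}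

theorem symm (h : DualGauges N N') : DualGauges N' N where
  holder P Q hP hQ := by
    rw [Matrix.trace_mul_comm, mul_comm]
    exact h.holder Q P hQ hP
  attain := h.attain'
  attain' := h.attain

variable {P Q : Matrix (Fin k) (Fin k) ℂ}

theorem nonneg (h : DualGauges N N') (hP : P.PosSemidef) : 0 ≤ N P := by
  obtain ⟨Q, hQ, -, h1⟩ := h.attain P hP
  rw [← h1]
  exact trace_mul_re_nonneg hP hQ

theorem trace_mul_le (h : DualGauges N N') (hP : P.PosSemidef) (hQ : Q.PosSemidef)
    (hQ1 : N' Q ≤ 1) : (P * Q).trace.re ≤ N P :=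
  (h.holder P Q hP hQ).trans (mul_le_of_le_one_right (h.nonneg hP) hQ1)

/-- A gauge is the support function of the dual ball. Subadditivity, homogeneity, and convexity and
closedness of the ball all follow from this form. -/
theorem le_iff (h : DualGauges N N') (hP : P.PosSemidef) {r : ℝ} :
    N P ≤ r ↔ ∀ Q, Q.PosSemidef → N' Q ≤ 1 → (P * Q).trace.re ≤ r := by
  refine ⟨fun hr Q hQ hQ1 => (h.trace_mul_le hP hQ hQ1).trans hr, fun H => ?_⟩
  obtain ⟨Q, hQ, hQ1, h1⟩ := h.attain P hP
  rw [← h1]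
  exact H Q hQ hQ1

theorem add_le (h : DualGauges N N') (hP : P.PosSemidef) (hQ : Q.PosSemidef) :
    N (P + Q) ≤ N P + N Q := by
  rw [h.le_iff (hP.add hQ)]
  intro R hR hR1
  rw [Matrix.add_mul, Matrix.trace_add, Complex.add_re]
  exact add_le_add (h.trace_mul_le hP hR hR1) (h.trace_mul_le hQ hR hR1)

theorem smul_le (h : DualGauges N N') (hP : P.PosSemidef) {t : ℝ} (ht : 0 ≤ t) :
    N (t • P) ≤ t * N P := by
  rw [h.le_iff (posSemidef_real_smul hP ht)]
  intro R hR hR1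
  rw [Matrix.smul_mul, Matrix.trace_smul, Complex.smul_re, smul_eq_mul]
  exact mul_le_mul_of_nonneg_left (h.trace_mul_le hP hR hR1) ht

/-- Hölder against the identity matrix: this bounds the ball of `N` and makes `N` definite. -/
theorem trace_le (h : DualGauges N N') (hP : P.PosSemidef) : P.trace.re ≤ N P * N' 1 := by
  simpa using h.holder P 1 hP PosSemidef.one

theorem norm_le (h : DualGauges N N') (hP : P.PosSemidef) : ‖P‖ ≤ N P * N' 1 :=
  (norm_le_trace_re hP).trans (h.trace_le hP)

theorem eq_zero (h : DualGauges N N') (hP : P.PosSemidef) (h0 : N P = 0) : P = 0 := by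
  have := h.norm_le hP
  rw [h0, zero_mul] at this
  exact norm_le_zero_iff.1 this

theorem convex_ball (h : DualGauges N N') :
    Convex ℝ {P : Matrix (Fin k) (Fin k) ℂ | P.PosSemidef ∧ N P ≤ 1} := by
  rintro P ⟨hP, hP1⟩ Q ⟨hQ, hQ1⟩ a b ha hb hab
  have hP' := posSemidef_real_smul hP ha
  have hQ' := posSemidef_real_smul hQ hb
  refine ⟨hP'.add hQ', (h.add_le hP' hQ').trans ?_⟩
  have h1 := h.smul_le hP ha
  have h2 := h.smul_le hQ hb
  nlinarith

theorem isCompact_ball (h : DualGauges N N') :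
    IsCompact {P : Matrix (Fin k) (Fin k) ℂ | P.PosSemidef ∧ N P ≤ 1} := by
  have : ProperSpace (Matrix (Fin k) (Fin k) ℂ) := FiniteDimensional.proper ℂ _
  refine Metric.isCompact_of_isClosed_isBounded ?_ ?_
  -- Continuity of `N` is not among the assumptions; the ball is closed as an intersection of
  -- half-spaces given by the dual ball.
  · have : {P : Matrix (Fin k) (Fin k) ℂ | P.PosSemidef ∧ N P ≤ 1} =
        {P | P.PosSemidef} ∩ ⋂ Q : {Q : Matrix (Fin k) (Fin k) ℂ // Q.PosSemidef ∧ N' Q ≤ 1},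
          {P | (P * Q.1).trace.re ≤ 1} := by
      ext P
      simp only [Set.mem_ofPred_eq, Set.mem_inter_iff, Set.mem_iInter, Subtype.forall]
      exact and_congr_right fun hP => by rw [h.le_iff hP]; simp only [and_imp]
    rw [this]
    refine isClosed_posSemidef.inter (isClosed_iInter fun Q => isClosed_le ?_ continuous_const)
    exact Complex.continuous_re.comp ((continuous_id.mul continuous_const).matrix_trace)
  · refine (Metric.isBounded_closedBall (x := (0 : Matrix (Fin k) (Fin k) ℂ)) (r := N' 1)).subset ?_
    rintro P ⟨hP, hP1⟩
    rw [mem_closedBall_zero_iff]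
    refine (h.norm_le hP).trans (mul_le_of_le_one_left (h.symm.nonneg PosSemidef.one) hP1)

end DualGauges

/-! ### Unitarily invariant gauges -/

section spectral

variable {k : ℕ}

/-- The function of a Hermitian matrix obtained by applying `g` to its eigenvalues. -/
noncomputable def spectralGauge (g : (Fin k → ℝ) → ℝ) (P : Matrix (Fin k) (Fin k) ℂ) : ℝ :=
  open scoped Classical in if h : P.IsHermitian then g h.eigenvalues else 0

theorem spectralGauge_eq (g : (Fin k → ℝ) → ℝ) {P : Matrix (Fin k) (Fin k) ℂ}
    (hP : P.IsHermitian) : spectralGauge g P = g hP.eigenvalues :=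
  dif_pos hP

/-- The eigenvalues of `U diag(μ) U*` are the entries of `μ`, up to the order. -/
theorem map_eigenvalues_unitary_diagonal (U : unitaryGroup (Fin k) ℂ) (μ : Fin k → ℝ)
    (h : ((U : Matrix (Fin k) (Fin k) ℂ) * diagonal (fun i => (μ i : ℂ)) *
      (U : Matrix (Fin k) (Fin k) ℂ)ᴴ).IsHermitian) :
    Multiset.map h.eigenvalues Finset.univ.val = Multiset.map μ Finset.univ.val := by
  have h1 := h.roots_charpoly_eq_eigenvalues
  have hU : (U : Matrix (Fin k) (Fin k) ℂ)ᴴ * (U : Matrix (Fin k) (Fin k) ℂ) = 1 :=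
    Unitary.coe_star_mul_self U
  rw [charpoly_mul_comm, ← Matrix.mul_assoc, hU, Matrix.one_mul, charpoly_diagonal,
    Polynomial.roots_prod _ _ (by simp [Finset.prod_ne_zero_iff, Polynomial.X_sub_C_ne_zero])] at h1
  simp only [Polynomial.roots_X_sub_C, Multiset.bind_singleton] at h1
  have := congrArg (Multiset.map Complex.re) h1
  simpa [Multiset.map_map, Function.comp_def] using this.symm

theorem sum_norm_sq_unitary_row (U : unitaryGroup (Fin k) ℂ) (i : Fin k) :
    ∑ j, ‖(U : Matrix (Fin k) (Fin k) ℂ) i j‖ ^ 2 = 1 := by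
  have h := congrFun (congrFun (Unitary.coe_mul_star_self U) i) i
  rw [Unitary.coe_star, star_eq_conjTranspose, Matrix.mul_apply, Matrix.one_apply_eq] at h
  have h2 := congrArg Complex.re h
  rw [Complex.re_sum, Complex.one_re] at h2
  rw [← h2]
  refine Finset.sum_congr rfl fun j _ => ?_
  rw [conjTranspose_apply, Complex.star_def, Complex.mul_conj', ← Complex.ofReal_pow,
    Complex.ofReal_re]

theorem sum_norm_sq_unitary_col (U : unitaryGroup (Fin k) ℂ) (j : Fin k) :
    ∑ i, ‖(U : Matrix (Fin k) (Fin k) ℂ) i j‖ ^ 2 = 1 := by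
  rw [← sum_norm_sq_unitary_row (star U) j]
  refine Finset.sum_congr rfl fun i _ => ?_
  rw [Unitary.coe_star, star_apply, norm_star]

/-- The trace pairing of two Hermitian matrices depends on their eigenvalues and on the weights
`|W_ij|²` with `W = U* V`. These weights form a doubly stochastic matrix, which reduces trace Hölder
to an inequality for vectors. -/
theorem trace_unitary_diagonal_mul (U V : unitaryGroup (Fin k) ℂ) (a b : Fin k → ℝ) :
    (((U : Matrix (Fin k) (Fin k) ℂ) * diagonal (fun i => (a i : ℂ)) *
      (U : Matrix (Fin k) (Fin k) ℂ)ᴴ) * ((V : Matrix (Fin k) (Fin k) ℂ) *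
      diagonal (fun i => (b i : ℂ)) * (V : Matrix (Fin k) (Fin k) ℂ)ᴴ)).trace.re =
    ∑ i, ∑ j, a i * b j * ‖((star U * V : unitaryGroup (Fin k) ℂ) :
      Matrix (Fin k) (Fin k) ℂ) i j‖ ^ 2 := by
  set W : Matrix (Fin k) (Fin k) ℂ := ((star U * V : unitaryGroup (Fin k) ℂ) :
      Matrix (Fin k) (Fin k) ℂ) with hW
  have hW1 : W = (U : Matrix (Fin k) (Fin k) ℂ)ᴴ * V := rfl
  have hW2 : Wᴴ = (V : Matrix (Fin k) (Fin k) ℂ)ᴴ * U := by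
    rw [hW1, conjTranspose_mul, conjTranspose_conjTranspose]
  have h : (((U : Matrix (Fin k) (Fin k) ℂ) * diagonal (fun i => (a i : ℂ)) *
      (U : Matrix (Fin k) (Fin k) ℂ)ᴴ) * ((V : Matrix (Fin k) (Fin k) ℂ) *
      diagonal (fun i => (b i : ℂ)) * (V : Matrix (Fin k) (Fin k) ℂ)ᴴ)).trace =
      ((diagonal (fun i => (a i : ℂ)) * W) * (diagonal (fun i => (b i : ℂ)) * Wᴴ)).trace := by
    rw [hW2, hW1, Matrix.mul_assoc (U : Matrix (Fin k) (Fin k) ℂ), Matrix.mul_assoc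
      (U : Matrix (Fin k) (Fin k) ℂ), Matrix.trace_mul_comm]
    simp only [← Matrix.mul_assoc]
  rw [h]
  rw [Matrix.trace, Complex.re_sum]
  simp only [Matrix.diag, Matrix.mul_apply (M := diagonal _ * W), diagonal_mul, Complex.re_sum]
  refine Finset.sum_congr rfl fun i _ => Finset.sum_congr rfl fun j _ => ?_
  rw [conjTranspose_apply, Complex.star_def, mul_mul_mul_comm, Complex.mul_conj']
  norm_cast

/-- Dual symmetric gauges on `ℝ^k` induce dual gauges on positive semidefinite matrices. -/
theorem dualGauges_of_symmetric {g g' : (Fin k → ℝ) → ℝ}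
    (hperm : ∀ v v' : Fin k → ℝ, Multiset.map v Finset.univ.val = Multiset.map v' Finset.univ.val →
      g v = g v')
    (hperm' : ∀ v v' : Fin k → ℝ, Multiset.map v Finset.univ.val = Multiset.map v' Finset.univ.val →
      g' v = g' v')
    (hholder : ∀ (a b : Fin k → ℝ) (w : Fin k → Fin k → ℝ), 0 ≤ a → 0 ≤ b → (∀ i j, 0 ≤ w i j) →
      (∀ i, ∑ j, w i j = 1) → (∀ j, ∑ i, w i j = 1) →
      ∑ i, ∑ j, a i * b j * w i j ≤ g a * g' b)
    (hattain : ∀ a : Fin k → ℝ, 0 ≤ a → ∃ b : Fin k → ℝ, 0 ≤ b ∧ g' b ≤ 1 ∧ ∑ i, a i * b i = g a)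
    (hattain' : ∀ a : Fin k → ℝ, 0 ≤ a →
      ∃ b : Fin k → ℝ, 0 ≤ b ∧ g b ≤ 1 ∧ ∑ i, a i * b i = g' a) :
    DualGauges (spectralGauge g) (spectralGauge g') := by
  have key : ∀ (g g' : (Fin k → ℝ) → ℝ)
    (_ : ∀ v v' : Fin k → ℝ, Multiset.map v Finset.univ.val = Multiset.map v' Finset.univ.val →
      g' v = g' v')
    (_ : ∀ a : Fin k → ℝ, 0 ≤ a → ∃ b : Fin k → ℝ, 0 ≤ b ∧ g' b ≤ 1 ∧ ∑ i, a i * b i = g a)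
    (P : Matrix (Fin k) (Fin k) ℂ) (_ : P.PosSemidef), ∃ Q : Matrix (Fin k) (Fin k) ℂ,
      Q.PosSemidef ∧ spectralGauge g' Q ≤ 1 ∧ (P * Q).trace.re = spectralGauge g P := by
    intro g g' hperm hattain P hP
    -- The extremal `Q` is diagonal in the eigenbasis of `P`, with the extremal vector for the
    -- eigenvalues of `P` on its diagonal.
    obtain ⟨b, hb, hb1, hb2⟩ := hattain hP.isHermitian.eigenvalues fun i => hP.eigenvalues_nonneg i
    set U := hP.isHermitian.eigenvectorUnitary
    have hQ : ((U : Matrix (Fin k) (Fin k) ℂ) * diagonal (fun i => (b i : ℂ)) *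
        (U : Matrix (Fin k) (Fin k) ℂ)ᴴ).PosSemidef := by
      refine PosSemidef.mul_mul_conjTranspose_same (PosSemidef.diagonal fun i => ?_) _
      simpa using hb i
    refine ⟨_, hQ, ?_, ?_⟩
    · rw [spectralGauge_eq _ hQ.isHermitian,
        hperm _ _ (map_eigenvalues_unitary_diagonal U b hQ.isHermitian)]
      exact hb1
    · rw [spectralGauge_eq _ hP.isHermitian, ← hb2]
      conv_lhs => rw [eq_unitary_mul_diagonal_mul hP.isHermitian]
      rw [trace_unitary_diagonal_mul, Unitary.star_mul_self]
      refine Finset.sum_congr rfl fun i _ => ?_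
      rw [Finset.sum_eq_single i]
      · simp
      · intro j _ hj
        simp [Matrix.one_apply_ne hj.symm]
      · simp
  refine ⟨fun P Q hP hQ => ?_, key g g' hperm' hattain, key g' g hperm hattain'⟩
  rw [spectralGauge_eq _ hP.isHermitian, spectralGauge_eq _ hQ.isHermitian]
  conv_lhs => rw [eq_unitary_mul_diagonal_mul hP.isHermitian,
    eq_unitary_mul_diagonal_mul hQ.isHermitian]
  rw [trace_unitary_diagonal_mul]
  exact hholder _ _ _ (fun i => hP.eigenvalues_nonneg i) (fun i => hQ.eigenvalues_nonneg i)
    (fun i j => by positivity) (sum_norm_sq_unitary_row _) (sum_norm_sq_unitary_col _)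

/-- The `ℓ^r` norm of a vector with nonnegative entries. -/
noncomputable def lpGauge (r : ℝ) (v : Fin k → ℝ) : ℝ := (∑ i, v i ^ r) ^ (1 / r)

theorem lpGauge_congr (r : ℝ) (v v' : Fin k → ℝ)
    (h : Multiset.map v Finset.univ.val = Multiset.map v' Finset.univ.val) :
    lpGauge r v = lpGauge r v' := by
  have h1 := congrArg (fun s => (Multiset.map (fun t : ℝ => t ^ r) s).sum) h
  simp only [Multiset.map_map] at h1
  exact congrArg (· ^ (1 / r)) h1

theorem norm_congr_of_map_eq (v v' : Fin k → ℝ)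
    (h : Multiset.map v Finset.univ.val = Multiset.map v' Finset.univ.val) : ‖v‖ = ‖v'‖ := by
  have key : ∀ v v' : Fin k → ℝ,
      Multiset.map v Finset.univ.val = Multiset.map v' Finset.univ.val → ‖v‖ ≤ ‖v'‖ := by
    intro v v' h
    refine (pi_norm_le_iff_of_nonneg (norm_nonneg _)).2 fun i => ?_
    obtain ⟨j, -, hj⟩ := Multiset.mem_map.1 (h ▸ Multiset.mem_map_of_mem v (Finset.mem_univ i))
    rw [← hj]
    exact norm_le_pi_norm v' j
  exact le_antisymm (key v v' h) (key v' v h.symm)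

theorem lpGauge_one (v : Fin k → ℝ) : lpGauge 1 v = ∑ i, v i := by
  simp [lpGauge]

/-- The equality case of Hölder: `b` proportional to `a^{r-1}`, normalized in `ℓ^s`, and `b = 0`
when `∑ a_i^r = 0`. -/
theorem lpGauge_attain {r s : ℝ} (hrs : r.HolderConjugate s) {a : Fin k → ℝ} (ha : 0 ≤ a) :
    ∃ b : Fin k → ℝ, 0 ≤ b ∧ lpGauge s b ≤ 1 ∧ ∑ i, a i * b i = lpGauge r a := by
  have hS : 0 ≤ ∑ i, a i ^ r := Finset.sum_nonneg fun i _ => Real.rpow_nonneg (ha i) _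
  rcases hS.eq_or_lt with h0 | h0
  · refine ⟨0, le_rfl, ?_, ?_⟩
    · simp [lpGauge, Real.zero_rpow hrs.symm.ne_zero, Real.zero_rpow (inv_ne_zero hrs.symm.ne_zero)]
    · simp [lpGauge, ← h0, Real.zero_rpow (inv_ne_zero hrs.ne_zero)]
  · set T := ∑ i, a i ^ r with hT
    have hb : ∀ i, 0 ≤ a i ^ (r - 1) / T ^ (1 / s) := fun i =>
      div_nonneg (Real.rpow_nonneg (ha i) _) (Real.rpow_nonneg hS _)
    refine ⟨fun i => a i ^ (r - 1) / T ^ (1 / s), hb, ?_, ?_⟩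
    · have h1 : ∀ i, (a i ^ (r - 1) / T ^ (1 / s)) ^ s = a i ^ r / T := by
        intro i
        rw [Real.div_rpow (Real.rpow_nonneg (ha i) _) (Real.rpow_nonneg hS _),
          ← Real.rpow_mul (ha i), ← Real.rpow_mul hS, one_div_mul_cancel hrs.symm.ne_zero,
          Real.rpow_one, hrs.sub_one_mul_conj]
      simp only [lpGauge, h1]
      rw [← Finset.sum_div, ← hT, div_self h0.ne', Real.one_rpow]
    · have h1 : ∀ i, a i * (a i ^ (r - 1) / T ^ (1 / s)) = a i ^ r / T ^ (1 / s) := by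
        intro i
        rw [← mul_div_assoc, mul_comm, ← Real.rpow_add_one' (ha i) (by simpa using hrs.ne_zero),
          sub_add_cancel]
      simp only [h1]
      rw [← Finset.sum_div, ← hT, lpGauge, ← hT, div_eq_iff (Real.rpow_pos_of_pos h0 _).ne',
        ← Real.rpow_add h0, one_div, one_div, hrs.inv_add_inv_eq_one, Real.rpow_one]

/-- Split each weight as `w = w^{1/r} w^{1/s}` and apply Hölder over pairs of indices. The row sums
then remove the weights from the factor in `a`, the column sums from the factor in `b`. -/
theorem dualGauges_lp {r s : ℝ} (hrs : r.HolderConjugate s) :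
    DualGauges (k := k) (spectralGauge (lpGauge r)) (spectralGauge (lpGauge s)) := by
  refine dualGauges_of_symmetric (lpGauge_congr r) (lpGauge_congr s) ?_
    (fun a ha => lpGauge_attain hrs ha) (fun a ha => lpGauge_attain hrs.symm ha)
  intro a b w ha hb hw hrow hcol
  have h := Real.inner_le_Lp_mul_Lq_of_nonneg (s := (Finset.univ : Finset (Fin k × Fin k)))
    (f := fun x => a x.1 * w x.1 x.2 ^ (1 / r)) (g := fun x => b x.2 * w x.1 x.2 ^ (1 / s)) hrs
    (fun x _ => mul_nonneg (ha _) (Real.rpow_nonneg (hw _ _) _))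
    (fun x _ => mul_nonneg (hb _) (Real.rpow_nonneg (hw _ _) _))
  have e1 : ∑ x : Fin k × Fin k, a x.1 * w x.1 x.2 ^ (1 / r) * (b x.2 * w x.1 x.2 ^ (1 / s)) =
      ∑ i, ∑ j, a i * b j * w i j := by
    rw [Fintype.sum_prod_type]
    refine Finset.sum_congr rfl fun i _ => Finset.sum_congr rfl fun j _ => ?_
    rw [mul_mul_mul_comm, ← Real.rpow_add_of_nonneg (hw i j) (one_div_nonneg.2 hrs.nonneg)
      (one_div_nonneg.2 hrs.symm.nonneg), one_div, one_div, hrs.inv_add_inv_eq_one, Real.rpow_one]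
  have e2 : ∑ x : Fin k × Fin k, (a x.1 * w x.1 x.2 ^ (1 / r)) ^ r = ∑ i, a i ^ r := by
    rw [Fintype.sum_prod_type]
    refine Finset.sum_congr rfl fun i _ => ?_
    conv_rhs => rw [← mul_one (a i ^ r), ← hrow i, Finset.mul_sum]
    refine Finset.sum_congr rfl fun j _ => ?_
    rw [Real.mul_rpow (ha i) (Real.rpow_nonneg (hw i j) _), ← Real.rpow_mul (hw i j),
      one_div_mul_cancel hrs.ne_zero, Real.rpow_one]
  have e3 : ∑ x : Fin k × Fin k, (b x.2 * w x.1 x.2 ^ (1 / s)) ^ s = ∑ j, b j ^ s := by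
    rw [Fintype.sum_prod_type_right]
    refine Finset.sum_congr rfl fun j _ => ?_
    conv_rhs => rw [← mul_one (b j ^ s), ← hcol j, Finset.mul_sum]
    refine Finset.sum_congr rfl fun i _ => ?_
    rw [Real.mul_rpow (hb j) (Real.rpow_nonneg (hw i j) _), ← Real.rpow_mul (hw i j),
      one_div_mul_cancel hrs.symm.ne_zero, Real.rpow_one]
  rw [e1, e2, e3] at h
  exact h

/-- The endpoint pair `ℓ^∞`, `ℓ^1`: the maximum is attained against the coordinate vector of a
largest entry, the sum against the all-ones vector. -/
theorem dualGauges_norm_trace :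
    DualGauges (k := k) (spectralGauge (fun v => ‖v‖)) (spectralGauge (lpGauge 1)) := by
  refine dualGauges_of_symmetric norm_congr_of_map_eq (lpGauge_congr 1) ?_ ?_ ?_
  · intro a b w ha hb hw hrow hcol
    rw [lpGauge_one, Finset.sum_comm, Finset.mul_sum]
    refine Finset.sum_le_sum fun j _ => ?_
    rw [← mul_one (‖a‖ * b j), ← hcol j, Finset.mul_sum]
    refine Finset.sum_le_sum fun i _ => mul_le_mul_of_nonneg_right
      (mul_le_mul_of_nonneg_right ?_ (hb j)) (hw i j)
    exact (Real.le_norm_self _).trans (norm_le_pi_norm a i)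
  · intro a ha
    -- For `k = 0` there is no largest entry.
    rcases isEmpty_or_nonempty (Fin k) with he | he
    · refine ⟨0, le_rfl, by simp [lpGauge_one], ?_⟩
      simp [Subsingleton.elim a 0]
    · obtain ⟨i, hi⟩ := Finite.exists_max a
      refine ⟨Pi.single i 1, Pi.single_nonneg.2 zero_le_one, by simp [lpGauge_one], ?_⟩
      have : ‖a‖ = a i := by
        refine le_antisymm ((pi_norm_le_iff_of_nonneg (ha i)).2 fun j => ?_) ?_
        · rw [Real.norm_of_nonneg (ha j)]
          exact hi j
        · exact (Real.le_norm_self _).trans (norm_le_pi_norm a i)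
      simp [this, Pi.single_apply]
  · intro a ha
    refine ⟨1, zero_le_one, ?_, by simp [lpGauge_one]⟩
    exact (pi_norm_le_iff_of_nonneg zero_le_one).2 fun i => by simp

theorem spectralGauge_norm {P : Matrix (Fin k) (Fin k) ℂ} (hP : P.IsHermitian) :
    spectralGauge (fun v => ‖v‖) P = ‖P‖ := by
  rw [spectralGauge_eq _ hP, norm_eq_norm_eigenvalues hP]

theorem spectralGauge_conjTranspose_mul_self (g : (Fin k → ℝ) → ℝ)
    (a : Matrix (Fin k) (Fin k) ℂ) :
    spectralGauge g (aᴴ * a) = spectralGauge g (a * aᴴ) := by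
  rw [spectralGauge_eq _ (isHermitian_conjTranspose_mul_self a),
    spectralGauge_eq _ (isHermitian_mul_conjTranspose_self a)]
  congr 1
  rw [IsHermitian.eigenvalues_eq_eigenvalues_iff, charpoly_mul_comm]

theorem sqrt_spectralGauge_norm_mul_conjTranspose (a : Matrix (Fin k) (Fin k) ℂ) :
    √(spectralGauge (fun v => ‖v‖) (a * aᴴ)) = ‖a‖ := by
  rw [spectralGauge_norm (isHermitian_mul_conjTranspose_self a), ← star_eq_conjTranspose,
    CStarRing.norm_self_mul_star, Real.sqrt_mul_self (norm_nonneg _)]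

theorem sqrt_spectralGauge_norm_conjTranspose_mul (a : Matrix (Fin k) (Fin k) ℂ) :
    √(spectralGauge (fun v => ‖v‖) (aᴴ * a)) = ‖a‖ := by
  rw [spectralGauge_conjTranspose_mul_self, sqrt_spectralGauge_norm_mul_conjTranspose]

/-- The exponent is halved because the eigenvalues of `a* a` are the squares of the singular values.
-/
theorem sqrt_spectralGauge_lp_conjTranspose_mul {p : ℝ} (hp : 0 < p)
    (a : Matrix (Fin k) (Fin k) ℂ) :
    √(spectralGauge (lpGauge (p / 2)) (aᴴ * a)) = schattenNorm p a := by
  have h0 : ∀ i, 0 ≤ (isHermitian_conjTranspose_mul_self a).eigenvalues i := fun i =>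
    (posSemidef_conjTranspose_mul_self a).eigenvalues_nonneg i
  rw [spectralGauge_eq _ (isHermitian_conjTranspose_mul_self a), lpGauge, schattenNorm,
    Real.sqrt_eq_rpow, ← Real.rpow_mul (Finset.sum_nonneg fun i _ => Real.rpow_nonneg (h0 i) _)]
  congr 1
  · refine Finset.sum_congr rfl fun i _ => ?_
    rw [Real.sqrt_eq_rpow, ← Real.rpow_mul (h0 i)]
    congr 1
    ring
  · field_simp

theorem sqrt_spectralGauge_lp_mul_conjTranspose {p : ℝ} (hp : 0 < p)
    (a : Matrix (Fin k) (Fin k) ℂ) :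
    √(spectralGauge (lpGauge (p / 2)) (a * aᴴ)) = schattenNorm p a := by
  rw [← spectralGauge_conjTranspose_mul_self, sqrt_spectralGauge_lp_conjTranspose_mul hp]

end spectral

/-! ### Bimodule operations -/

section biMul

variable {F : Type*} [AddCommGroup F] [Module ℂ F]
  {l m n o q r : Type*} [Fintype m] [Fintype n]

theorem biMul_biMul [Fintype o] [Fintype q] (a : Matrix l m ℂ) (b : Matrix m n ℂ)
    (x : Matrix n o F) (c : Matrix o q ℂ) (d : Matrix q r ℂ) :
    biMul a (biMul b x c) d = biMul (a * b) x (c * d) := by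
  ext i j
  simp only [biMul, Matrix.of_apply, Matrix.mul_apply, Finset.smul_sum, smul_smul,
    Finset.sum_mul, Finset.mul_sum, Finset.sum_smul]
  calc _ = ∑ s, ∑ u, ∑ t, ∑ v, (a i s * d t j * (b s u * c v t)) • x u v := by
        refine Finset.sum_congr rfl fun s _ => ?_
        rw [Finset.sum_comm]
    _ = ∑ u, ∑ s, ∑ v, ∑ t, (a i s * d t j * (b s u * c v t)) • x u v := by
        rw [Finset.sum_comm]
        refine Finset.sum_congr rfl fun u _ => Finset.sum_congr rfl fun s _ => ?_
        rw [Finset.sum_comm]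
    _ = _ := by
        refine Finset.sum_congr rfl fun u _ => ?_
        rw [Finset.sum_comm]
        refine Finset.sum_congr rfl fun v _ => Finset.sum_comm.trans ?_
        refine Finset.sum_congr rfl fun t _ => Finset.sum_congr rfl fun s _ => ?_
        congr 1
        ring

theorem one_biMul_one [DecidableEq m] [DecidableEq n] (x : Matrix m n F) :
    biMul (1 : Matrix m m ℂ) x (1 : Matrix n n ℂ) = x := by
  ext i j
  simp [biMul, Matrix.one_apply, ite_smul]

theorem biMul_smul_smul_smul (s t u : ℂ) (a : Matrix l m ℂ) (x : Matrix m n F)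
    (b : Matrix n o ℂ) : biMul (s • a) (t • x) (u • b) = (s * t * u) • biMul a x b := by
  ext i j
  simp only [biMul, Matrix.of_apply, Matrix.smul_apply, Finset.smul_sum, smul_smul, smul_eq_mul]
  refine Finset.sum_congr rfl fun s _ => Finset.sum_congr rfl fun t _ => ?_
  congr 1
  ring

theorem biMul_zero (a : Matrix l m ℂ) (b : Matrix n o ℂ) : biMul a (0 : Matrix m n F) b = 0 := by
  ext i j
  simp [biMul]

theorem zero_biMul (x : Matrix m n F) (b : Matrix n o ℂ) :
    biMul (0 : Matrix l m ℂ) x b = 0 := by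
  ext i j
  simp [biMul]

theorem biMul_zero_right (a : Matrix l m ℂ) (x : Matrix m n F) :
    biMul a x (0 : Matrix n o ℂ) = 0 := by
  ext i j
  simp [biMul]

/-- The product of the row `[c₁ c₂]`, the block diagonal matrix `z₁ ⊕ z₂`, and the column
`[d₁ d₂]ᵀ`. -/
theorem biMul_dirSum {m₁ m₂ : ℕ} (c₁ : Matrix l (Fin m₁) ℂ) (c₂ : Matrix l (Fin m₂) ℂ)
    (z₁ : Matrix (Fin m₁) (Fin m₁) F) (z₂ : Matrix (Fin m₂) (Fin m₂) F)
    (d₁ : Matrix (Fin m₁) r ℂ) (d₂ : Matrix (Fin m₂) r ℂ) :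
    biMul ((fromCols c₁ c₂).submatrix id finSumFinEquiv.symm) (dirSum z₁ z₂)
      ((fromRows d₁ d₂).submatrix finSumFinEquiv.symm id) = biMul c₁ z₁ d₁ + biMul c₂ z₂ d₂ := by
  ext i j
  simp only [biMul, Matrix.of_apply, Matrix.add_apply, Matrix.submatrix_apply, id_eq, dirSum]
  rw [← finSumFinEquiv.sum_comp]
  simp only [← finSumFinEquiv.sum_comp (fun t => _ • fromBlocks z₁ 0 0 z₂ _ _),
    Equiv.symm_apply_apply, Fintype.sum_sum_type]
  simp

end biMul

/-! ### Factorizations -/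

section fac

variable {F : Type*} [NormedAddCommGroup F] [NormedSpace ℂ F] (S : OperatorSpace F) {k : ℕ}

/-- There is a factorization `y = c z d`, where `z` is a square matrix of any size of norm at most
`1`, and where `P = c c*`, `R = d* d`. -/
def Fac (P R : Matrix (Fin k) (Fin k) ℂ) (y : Matrix (Fin k) (Fin k) F) : Prop :=
  ∃ (m : ℕ) (c : Matrix (Fin k) (Fin m) ℂ) (z : Matrix (Fin m) (Fin m) F)
    (d : Matrix (Fin m) (Fin k) ℂ), S.matNorm m z ≤ 1 ∧ P = c * cᴴ ∧ R = dᴴ * d ∧ y = biMul c z d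

variable {S} {P R P' R' : Matrix (Fin k) (Fin k) ℂ} {y y' : Matrix (Fin k) (Fin k) F}

theorem Fac.posSemidef_left (h : Fac S P R y) : P.PosSemidef := by
  obtain ⟨m, c, z, d, -, rfl, -, -⟩ := h
  exact posSemidef_self_mul_conjTranspose c

theorem Fac.posSemidef_right (h : Fac S P R y) : R.PosSemidef := by
  obtain ⟨m, c, z, d, -, -, rfl, -⟩ := h
  exact posSemidef_conjTranspose_mul_self d

theorem Fac.zero : Fac S (0 : Matrix (Fin k) (Fin k) ℂ) 0 0 := by
  refine ⟨k, 0, 0, 0, ?_, by simp, by simp, (biMul_zero _ _).symm⟩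
  rw [S.matNorm_zero]
  exact zero_le_one

/-- Place the outer factors in a block row and a block column and the inner ones in `z ⊕ z'`, still
of norm at most `1` by Ruan's axiom. The inner size grows, which is why `Fac` leaves it free. -/
theorem Fac.add (h : Fac S P R y) (h' : Fac S P' R' y') : Fac S (P + P') (R + R') (y + y') := by
  obtain ⟨m, c, z, d, hz, rfl, rfl, rfl⟩ := h
  obtain ⟨m', c', z', d', hz', rfl, rfl, rfl⟩ := h'
  refine ⟨m + m', (fromCols c c').submatrix id finSumFinEquiv.symm, dirSum z z',
    (fromRows d d').submatrix finSumFinEquiv.symm id, ?_, ?_, ?_, (biMul_dirSum _ _ _ _ _ _).symm⟩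
  · rw [S.matNorm_dirSum]
    exact max_le hz hz'
  · rw [conjTranspose_submatrix, Matrix.submatrix_mul_equiv,
      conjTranspose_fromCols_eq_fromRows_conjTranspose, fromCols_mul_fromRows, submatrix_id_id]
  · rw [conjTranspose_submatrix, Matrix.submatrix_mul_equiv,
      conjTranspose_fromRows_eq_fromCols_conjTranspose, fromCols_mul_fromRows, submatrix_id_id]

theorem Fac.smul (h : Fac S P R y) {t : ℝ} (ht : 0 ≤ t) : Fac S (t • P) (t • R) ((t : ℂ) • y) := by
  obtain ⟨m, c, z, d, hz, rfl, rfl, rfl⟩ := h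
  -- The scalar is shared as `√t` between the outer factors, so that `P` and `R` scale by `t` and
  -- `z` is unchanged.
  have h1 : ((√t : ℝ) : ℂ) * ((√t : ℝ) : ℂ) = (t : ℂ) := by
    rw [← Complex.ofReal_mul, Real.mul_self_sqrt ht]
  have h2 : ∀ M : Matrix (Fin k) (Fin k) ℂ, t • M = (t : ℂ) • M := fun M => by
    ext i j
    simp
  refine ⟨m, ((√t : ℝ) : ℂ) • c, z, ((√t : ℝ) : ℂ) • d, hz, ?_, ?_, ?_⟩
  · rw [conjTranspose_smul, Matrix.smul_mul, Matrix.mul_smul, smul_smul, Complex.star_def,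
      Complex.conj_ofReal, h1, h2]
  · rw [conjTranspose_smul, Matrix.smul_mul, Matrix.mul_smul, smul_smul, Complex.star_def,
      Complex.conj_ofReal, h1, h2]
  · have := biMul_smul_smul_smul ((√t : ℝ) : ℂ) 1 ((√t : ℝ) : ℂ) c z d
    rw [one_smul, mul_one, h1] at this
    exact this.symm

theorem Fac.sum {ι : Type*} (s : Finset ι) (p r : ι → Matrix (Fin k) (Fin k) ℂ)
    (x : ι → Matrix (Fin k) (Fin k) F) (h : ∀ i, Fac S (p i) (r i) (x i)) :
    Fac S (∑ i ∈ s, p i) (∑ i ∈ s, r i) (∑ i ∈ s, x i) := by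
  classical
  induction s using Finset.induction_on with
  | empty => simpa using Fac.zero
  | insert i s hi ih =>
    rw [Finset.sum_insert hi, Finset.sum_insert hi, Finset.sum_insert hi]
    exact (h i).add ih

end fac

/-! ### The norms defined by factorizations -/

section gauge

variable {F : Type*} [NormedAddCommGroup F] [NormedSpace ℂ F] {k : ℕ}

/-- The infimum of `N₁(c c*)^{1/2} ‖z‖ N₂(d* d)^{1/2}` over all factorizations `y = c z d`. -/
noncomputable def facNorm (S : OperatorSpace F) (N₁ N₂ : Matrix (Fin k) (Fin k) ℂ → ℝ)
    (y : Matrix (Fin k) (Fin k) F) : ℝ :=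
  sInf {r | ∃ (c d : Matrix (Fin k) (Fin k) ℂ) (z : Matrix (Fin k) (Fin k) F),
    y = biMul c z d ∧ r = √(N₁ (c * cᴴ)) * S.matNorm k z * √(N₂ (dᴴ * d))}

variable {S : OperatorSpace F} {N₁ N₁' N₂ N₂' : Matrix (Fin k) (Fin k) ℂ → ℝ}
  {P R : Matrix (Fin k) (Fin k) ℂ} {y y' : Matrix (Fin k) (Fin k) F}

theorem facNorm_biMul_le (S : OperatorSpace F) (N₁ N₂ : Matrix (Fin k) (Fin k) ℂ → ℝ)
    (c d : Matrix (Fin k) (Fin k) ℂ) (z : Matrix (Fin k) (Fin k) F) :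
    facNorm S N₁ N₂ (biMul c z d) ≤ √(N₁ (c * cᴴ)) * S.matNorm k z * √(N₂ (dᴴ * d)) := by
  refine csInf_le ⟨0, ?_⟩ ⟨c, d, z, rfl, rfl⟩
  rintro r ⟨c, d, z, -, rfl⟩
  have := S.matNorm_nonneg k z
  positivity

theorem facNorm_set_nonempty (S : OperatorSpace F) (N₁ N₂ : Matrix (Fin k) (Fin k) ℂ → ℝ)
    (y : Matrix (Fin k) (Fin k) F) :
    {r | ∃ (c d : Matrix (Fin k) (Fin k) ℂ) (z : Matrix (Fin k) (Fin k) F),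
    y = biMul c z d ∧ r = √(N₁ (c * cᴴ)) * S.matNorm k z * √(N₂ (dᴴ * d))}.Nonempty :=
  ⟨_, 1, 1, y, (one_biMul_one y).symm, rfl⟩

theorem facNorm_nonneg (S : OperatorSpace F) (N₁ N₂ : Matrix (Fin k) (Fin k) ℂ → ℝ)
    (y : Matrix (Fin k) (Fin k) F) : 0 ≤ facNorm S N₁ N₂ y := by
  refine le_csInf (facNorm_set_nonempty S N₁ N₂ y) ?_
  rintro r ⟨c, d, z, -, rfl⟩
  have := S.matNorm_nonneg k z
  positivity

theorem facNorm_le_matNorm (S : OperatorSpace F) (N₁ N₂ : Matrix (Fin k) (Fin k) ℂ → ℝ)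
    (y : Matrix (Fin k) (Fin k) F) :
    facNorm S N₁ N₂ y ≤ √(N₁ 1) * S.matNorm k y * √(N₂ 1) := by
  have h := facNorm_biMul_le S N₁ N₂ 1 1 y
  rwa [one_biMul_one, conjTranspose_one, Matrix.one_mul] at h

theorem facNorm_smul_le (S : OperatorSpace F) (N₁ N₂ : Matrix (Fin k) (Fin k) ℂ → ℝ) (t : ℂ)
    (y : Matrix (Fin k) (Fin k) F) : facNorm S N₁ N₂ (t • y) ≤ ‖t‖ * facNorm S N₁ N₂ y := by
  rcases eq_or_ne t 0 with rfl | ht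
  · rw [zero_smul, norm_zero, zero_mul]
    refine (facNorm_le_matNorm S N₁ N₂ 0).trans ?_
    rw [S.matNorm_zero, mul_zero, zero_mul]
  rw [mul_comm, ← div_le_iff₀ (norm_pos_iff.2 ht)]
  refine le_csInf (facNorm_set_nonempty S N₁ N₂ y) ?_
  rintro r ⟨c, d, z, rfl, rfl⟩
  rw [div_le_iff₀ (norm_pos_iff.2 ht)]
  have h1 := biMul_smul_smul_smul 1 t 1 c z d
  rw [one_smul, one_smul, one_mul, mul_one] at h1
  rw [← h1]
  refine (facNorm_biMul_le S N₁ N₂ _ _ _).trans_eq ?_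
  rw [S.matNorm_smul]
  ring

theorem facNorm_smul (S : OperatorSpace F) (N₁ N₂ : Matrix (Fin k) (Fin k) ℂ → ℝ) (t : ℂ)
    (y : Matrix (Fin k) (Fin k) F) : facNorm S N₁ N₂ (t • y) = ‖t‖ * facNorm S N₁ N₂ y := by
  refine le_antisymm (facNorm_smul_le S N₁ N₂ t y) ?_
  rcases eq_or_ne t 0 with rfl | ht
  · rw [norm_zero, zero_mul]
    exact facNorm_nonneg _ _ _ _
  · have h := facNorm_smul_le S N₁ N₂ t⁻¹ (t • y)
    rwa [smul_smul, inv_mul_cancel₀ ht, one_smul, norm_inv, ← div_eq_inv_mul,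
      le_div_iff₀' (norm_pos_iff.2 ht)] at h

/-- Factorizations through square matrices of size `k`, with a scaling that balances the factors. -/
theorem exists_fac_of_facNorm_lt (h₁ : DualGauges N₁ N₁') (h₂ : DualGauges N₂ N₂') {r : ℝ}
    (hr : facNorm S N₁ N₂ y < r) : ∃ P R, Fac S P R y ∧ N₁ P ≤ r ∧ N₂ R ≤ r := by
  have hr0 : 0 < r := (facNorm_nonneg S N₁ N₂ y).trans_lt hr
  have hzero : y = 0 → ∃ P R, Fac S P R y ∧ N₁ P ≤ r ∧ N₂ R ≤ r := by
    rintro rfl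
    refine ⟨0, 0, Fac.zero, ?_, ?_⟩
    · have := h₁.smul_le PosSemidef.zero le_rfl
      rw [zero_smul, zero_mul] at this
      exact this.trans hr0.le
    · have := h₂.smul_le PosSemidef.zero le_rfl
      rw [zero_smul, zero_mul] at this
      exact this.trans hr0.le
  obtain ⟨s, ⟨c, d, z, hy, rfl⟩, hlt⟩ := exists_lt_of_csInf_lt (facNorm_set_nonempty S N₁ N₂ y) hr
  have hc := posSemidef_self_mul_conjTranspose c
  have hd := posSemidef_conjTranspose_mul_self d
  rcases (h₁.nonneg hc).eq_or_lt with hα | hα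
  · have : c = 0 := self_mul_conjTranspose_eq_zero.1 (h₁.eq_zero hc hα.symm)
    exact hzero (by rw [hy, this, zero_biMul])
  rcases (h₂.nonneg hd).eq_or_lt with hγ | hγ
  · have : d = 0 := conjTranspose_mul_self_eq_zero.1 (h₂.eq_zero hd hγ.symm)
    exact hzero (by rw [hy, this, biMul_zero_right])
  set α := √(N₁ (c * cᴴ)) with hα'
  set γ := √(N₂ (dᴴ * d)) with hγ'
  have hαp : 0 < α := Real.sqrt_pos.2 hα
  have hγp : 0 < γ := Real.sqrt_pos.2 hγ
  have hr2 : √r * √r = r := Real.mul_self_sqrt hr0.le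
  have hrp : 0 < √r := Real.sqrt_pos.2 hr0
  -- With these scalings both outer gauges become at most `r`, and the inverse scaling brings `z`
  -- into the unit ball because `α ‖z‖ γ < r`.
  set s : ℝ := √r / α with hs
  set t : ℝ := √r / γ with ht
  have hs0 : 0 < s := div_pos hrp hαp
  have ht0 : 0 < t := div_pos hrp hγp
  have hreal : ∀ (u : ℝ) (M : Matrix (Fin k) (Fin k) ℂ), ((u : ℂ) * (u : ℂ)) • M = (u * u) • M := by
    intro u M
    ext i j
    simp
  refine ⟨_, _, ⟨k, (s : ℂ) • c, (((s * t)⁻¹ : ℝ) : ℂ) • z, (t : ℂ) • d, ?_, rfl, rfl, ?_⟩, ?_, ?_⟩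
  · rw [S.matNorm_smul, Complex.norm_real, Real.norm_of_nonneg (by positivity), inv_mul_le_one₀
      (by positivity), hs, ht, div_mul_div_comm, hr2, le_div_iff₀ (by positivity)]
    linarith
  · rw [biMul_smul_smul_smul, hy]
    have : (s : ℂ) * (((s * t)⁻¹ : ℝ) : ℂ) * (t : ℂ) = 1 := by
      rw [← Complex.ofReal_mul, ← Complex.ofReal_mul, ← Complex.ofReal_one]
      congr 1
      field_simp
    rw [this, one_smul]
  · rw [conjTranspose_smul, Matrix.smul_mul, Matrix.mul_smul, smul_smul, Complex.star_def,
      Complex.conj_ofReal, hreal]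
    refine (h₁.smul_le hc (by positivity)).trans_eq ?_
    rw [hs, div_mul_div_comm, hr2, hα', Real.mul_self_sqrt hα.le]
    field_simp
  · rw [conjTranspose_smul, Matrix.smul_mul, Matrix.mul_smul, smul_smul, Complex.star_def,
      Complex.conj_ofReal, hreal]
    refine (h₂.smul_le hd (by positivity)).trans_eq ?_
    rw [ht, div_mul_div_comm, hr2, hγ', Real.mul_self_sqrt hγ.le]
    field_simp

theorem sum_norm_sq_eq {n : Type*} [Fintype n] (w : n → ℂ) :
    ∑ i, ‖w i‖ ^ 2 = (star w ⬝ᵥ w).re := by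
  rw [dotProduct, Complex.re_sum]
  refine Finset.sum_congr rfl fun i _ => ?_
  rw [Pi.star_apply, Complex.star_def, Complex.conj_mul', ← Complex.ofReal_pow, Complex.ofReal_re]

theorem isUnit_det_of_conjTranspose_mul_self_eq {Q B : Matrix (Fin k) (Fin k) ℂ}
    (hQ : Q.PosSemidef) {ε : ℝ} (hε : 0 < ε) (hB : Bᴴ * B = Q + ε • 1) : IsUnit B.det := by
  have h1 := (PosDef.posSemidef_add hQ
    ((PosDef.one : (1 : Matrix (Fin k) (Fin k) ℂ).PosDef).smul hε)).isUnit
  rw [← hB, isUnit_iff_isUnit_det, det_mul] at h1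
  exact isUnit_of_mul_isUnit_right h1

/-- A matrix `c` with `c c* ≤ B* B` factors as `B* u` with a contraction `u`. -/
theorem norm_inv_mul_le {m : ℕ} {B : Matrix (Fin k) (Fin k) ℂ} (hB : IsUnit B.det)
    (c : Matrix (Fin k) (Fin m) ℂ) (h : (Bᴴ * B - c * cᴴ).PosSemidef) : ‖(Bᴴ)⁻¹ * c‖ ≤ 1 := by
  have hB' : IsUnit (Bᴴ).det := by rw [det_conjTranspose]; exact hB.star
  rw [← l2_opNorm_conjTranspose]
  refine norm_le_of_sq _ zero_le_one fun v => ?_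
  set u := (Bᴴ)⁻¹ * c with hu
  have h1 : (1 - u * uᴴ).PosSemidef := by
    have h2 := h.mul_mul_conjTranspose_same (Bᴴ)⁻¹
    have h3 : (Bᴴ)⁻¹ * (Bᴴ * B - c * cᴴ) * ((Bᴴ)⁻¹)ᴴ = 1 - u * uᴴ := by
      rw [Matrix.mul_sub, Matrix.sub_mul, hu, conjTranspose_mul,
        nonsing_inv_mul_cancel_left _ _ hB', conjTranspose_nonsing_inv,
        conjTranspose_conjTranspose, mul_nonsing_inv _ hB]
      simp only [Matrix.mul_assoc]
    rwa [h3] at h2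
  have h2 := h1.re_dotProduct_nonneg v
  have h3 : star v ᵥ* u = star (uᴴ *ᵥ v) := by rw [star_mulVec, conjTranspose_conjTranspose]
  rw [Matrix.sub_mulVec, one_mulVec, dotProduct_sub, ← mulVec_mulVec, dotProduct_mulVec, h3,
    map_sub, RCLike.re_eq_complex_re, ← sum_norm_sq_eq, ← sum_norm_sq_eq] at h2
  linarith

/-- A factorization through matrices of any size gives one through matrices of size `k`. -/
theorem Fac.facNorm_le (h₁ : DualGauges N₁ N₁') (h₂ : DualGauges N₂ N₂') (h : Fac S P R y) :
    facNorm S N₁ N₂ y ≤ (N₁ P + N₂ R) / 2 := by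
  have hone := (PosDef.one : (1 : Matrix (Fin k) (Fin k) ℂ).PosDef)
  have key : ∀ ε : ℝ, 0 < ε →
      facNorm S N₁ N₂ y ≤ (N₁ P + N₂ R) / 2 + ε * ((N₁ 1 + N₂ 1) / 2) := by
    -- Since `P` and `R` may be singular, `P + ε` and `R + ε` are factored instead as `B* B` and `A*
    -- A` with `A`, `B` invertible. The rectangular factors are then contractions times `B*` and
    -- `A`, and they are absorbed into `z`.
    intro ε hε
    have hP := h.posSemidef_left
    have hR := h.posSemidef_right
    have hε1 : (ε • (1 : Matrix (Fin k) (Fin k) ℂ)).PosDef := hone.smul hε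
    obtain ⟨B, hB⟩ := exists_conjTranspose_mul_self_eq (hP.add hε1.posSemidef)
    obtain ⟨A, hA⟩ := exists_conjTranspose_mul_self_eq (hR.add hε1.posSemidef)
    have hBu := isUnit_det_of_conjTranspose_mul_self_eq hP hε hB
    have hAu := isUnit_det_of_conjTranspose_mul_self_eq hR hε hA
    have hBu' : IsUnit (Bᴴ).det := by rw [det_conjTranspose]; exact hBu.star
    have hNP : N₁ (Bᴴ * B) ≤ N₁ P + ε * N₁ 1 := by
      rw [hB]
      exact (h₁.add_le hP hε1.posSemidef).trans (by gcongr; exact h₁.smul_le PosSemidef.one hε.le)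
    have hNR : N₂ (Aᴴ * A) ≤ N₂ R + ε * N₂ 1 := by
      rw [hA]
      exact (h₂.add_le hR hε1.posSemidef).trans (by gcongr; exact h₂.smul_le PosSemidef.one hε.le)
    obtain ⟨m, c, z, d, hz, rfl, rfl, rfl⟩ := h
    have hu : ‖(Bᴴ)⁻¹ * c‖ ≤ 1 := norm_inv_mul_le hBu c (by
      rw [hB, add_sub_cancel_left]; exact hε1.posSemidef)
    have hv : ‖d * A⁻¹‖ ≤ 1 := by
      rw [← l2_opNorm_conjTranspose, conjTranspose_mul, conjTranspose_nonsing_inv]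
      refine norm_inv_mul_le hAu dᴴ ?_
      rw [hA, conjTranspose_conjTranspose, add_sub_cancel_left]
      exact hε1.posSemidef
    have hy : biMul c z d = biMul Bᴴ (biMul ((Bᴴ)⁻¹ * c) z (d * A⁻¹)) A := by
      rw [biMul_biMul, mul_nonsing_inv_cancel_left _ _ hBu', Matrix.mul_assoc,
        nonsing_inv_mul _ hAu, Matrix.mul_one]
    have hw : S.matNorm k (biMul ((Bᴴ)⁻¹ * c) z (d * A⁻¹)) ≤ 1 := by
      refine (S.matNorm_biMul_le _ _ _ _ _).trans ?_
      have := S.matNorm_nonneg m z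
      calc _ ≤ (1 : ℝ) * 1 * 1 := by gcongr
        _ = 1 := by norm_num
    rw [hy]
    refine (facNorm_biMul_le _ _ _ _ _ _).trans ?_
    rw [conjTranspose_conjTranspose]
    have h3 : √(N₁ (Bᴴ * B)) * S.matNorm k (biMul ((Bᴴ)⁻¹ * c) z (d * A⁻¹)) * √(N₂ (Aᴴ * A)) ≤
        √(N₁ (Bᴴ * B)) * 1 * √(N₂ (Aᴴ * A)) := by gcongr
    have h4 := Real.sq_sqrt (h₁.nonneg (posSemidef_conjTranspose_mul_self B))
    have h5 := Real.sq_sqrt (h₂.nonneg (posSemidef_conjTranspose_mul_self A))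
    -- The arithmetic-geometric mean inequality turns the product of square roots into half the sum.
    nlinarith [sq_nonneg (√(N₁ (Bᴴ * B)) - √(N₂ (Aᴴ * A)))]
  refine le_of_forall_pos_le_add fun δ hδ => ?_
  have h10 : 0 ≤ (N₁ 1 + N₂ 1) / 2 :=
    div_nonneg (add_nonneg (h₁.nonneg hone.posSemidef) (h₂.nonneg hone.posSemidef)) zero_le_two
  -- The `+ 1` keeps the denominator positive when the gauges of the identity vanish, as for `k =
  -- 0`.
  refine (key (δ / ((N₁ 1 + N₂ 1) / 2 + 1)) (by positivity)).trans ?_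
  gcongr
  rw [div_mul_eq_mul_div, div_le_iff₀ (by positivity)]
  nlinarith

/-- Balanced, nearly optimal factorizations have both gauges below the norm plus `δ / 2`. Their
direct sum adds `P` and `R`, on which the gauges are subadditive. -/
theorem facNorm_add_le (h₁ : DualGauges N₁ N₁') (h₂ : DualGauges N₂ N₂')
    (y y' : Matrix (Fin k) (Fin k) F) :
    facNorm S N₁ N₂ (y + y') ≤ facNorm S N₁ N₂ y + facNorm S N₁ N₂ y' := by
  refine le_of_forall_pos_le_add fun δ hδ => ?_
  obtain ⟨P, R, hf, hP, hR⟩ := exists_fac_of_facNorm_lt (S := S) (y := y) h₁ h₂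
    (lt_add_of_pos_right _ (half_pos hδ))
  obtain ⟨P', R', hf', hP', hR'⟩ := exists_fac_of_facNorm_lt (S := S) (y := y') h₁ h₂
    (lt_add_of_pos_right _ (half_pos hδ))
  have h3 := (hf.add hf').facNorm_le h₁ h₂
  have h4 := h₁.add_le hf.posSemidef_left hf'.posSemidef_left
  have h5 := h₂.add_le hf.posSemidef_right hf'.posSemidef_right
  linarith

end gauge

/-! ### The trace pairing -/

section pairing

variable {F : Type*} [NormedAddCommGroup F] [NormedSpace ℂ F]

/-- The pairing of `M_{n,m}(F*)` and `M_{m,n}(F)` with `⟨c ⊗ η, a ⊗ x⟩ = tr(a c) ⟨η, x⟩`. -/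
noncomputable def pairing {m n : Type*} [Fintype m] [Fintype n] (η : Matrix n m (StrongDual ℂ F))
    (y : Matrix m n F) : ℂ :=
  ∑ i, ∑ j, η j i (y i j)

theorem pairing_add_right {m n : Type*} [Fintype m] [Fintype n] (η : Matrix n m (StrongDual ℂ F))
    (y y' : Matrix m n F) : pairing η (y + y') = pairing η y + pairing η y' := by
  simp [pairing, Finset.sum_add_distrib]

theorem pairing_smul_right {m n : Type*} [Fintype m] [Fintype n] (η : Matrix n m (StrongDual ℂ F))
    (t : ℂ) (y : Matrix m n F) : pairing η (t • y) = t * pairing η y := by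
  simp [pairing, Finset.mul_sum]

theorem pairing_smul_left {m n : Type*} [Fintype m] [Fintype n] (η : Matrix n m (StrongDual ℂ F))
    (t : ℂ) (y : Matrix m n F) : pairing (t • η) y = t * pairing η y := by
  simp [pairing, Finset.mul_sum]

theorem pairing_sum_right {m n : Type*} [Fintype m] [Fintype n] (η : Matrix n m (StrongDual ℂ F))
    {ι : Type*} (s : Finset ι) (y : ι → Matrix m n F) :
    pairing η (∑ i ∈ s, y i) = ∑ i ∈ s, pairing η (y i) := by
  classical
  induction s using Finset.induction_on with
  | empty => simp [pairing]
  | insert i s hi ih => rw [Finset.sum_insert hi, Finset.sum_insert hi, pairing_add_right, ih]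

theorem pairing_single_right {m n : Type*} [Fintype m] [Fintype n] [DecidableEq m] [DecidableEq n]
    (η : Matrix n m (StrongDual ℂ F)) (i : m) (j : n) (x : F) :
    pairing η (Matrix.single i j x) = η j i x := by
  rw [pairing, Finset.sum_eq_single i, Finset.sum_eq_single j]
  · simp
  · intro j' _ hj'
    simp [hj'.symm]
  · simp
  · intro i' _ hi'
    simp [hi'.symm]
  · simp

theorem pairing_single_left {m n : Type*} [Fintype m] [Fintype n] [DecidableEq m] [DecidableEq n]
    (ξ : StrongDual ℂ F) (i : m) (j : n) (y : Matrix m n F) :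
    pairing (Matrix.single j i ξ) y = ξ (y i j) := by
  rw [pairing, Finset.sum_eq_single i, Finset.sum_eq_single j]
  · simp
  · intro j' _ hj'
    simp [hj'.symm]
  · simp
  · intro i' _ hi'
    simp [hi'.symm]
  · simp

theorem pairing_tmul {k : ℕ} (a c : Matrix (Fin k) (Fin k) ℂ) (x : F) (η : StrongDual ℂ F) :
    pairing (tmul c η) (tmul a x) = (a * c).trace * η x := by
  simp only [pairing, tmul, Matrix.of_apply, Matrix.trace, Matrix.diag, Matrix.mul_apply,
    Finset.sum_mul]
  refine Finset.sum_congr rfl fun i _ => Finset.sum_congr rfl fun j _ => ?_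
  simp
  ring

/-- Cyclicity of the trace. The right factor of `η` meets the left factor of `y` and conversely,
hence the order `N₂'`, `N₁'` in the dual norm. -/
theorem pairing_biMul_left {m n m' n' : Type*} [Fintype m] [Fintype n] [Fintype m'] [Fintype n']
    (a : Matrix n n' ℂ) (η : Matrix n' m' (StrongDual ℂ F)) (b : Matrix m' m ℂ)
    (y : Matrix m n F) : pairing (biMul a η b) y = pairing η (biMul b y a) := by
  simp only [pairing, biMul, Matrix.of_apply, _root_.sum_apply, _root_.smul_apply, map_sum,
    map_smul, smul_eq_mul]
  calc _ = ∑ i, ∑ j, ∑ t, ∑ s, a j s * b t i * η s t (y i j) := by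
        refine Finset.sum_congr rfl fun i _ => Finset.sum_congr rfl fun j _ => ?_
        rw [Finset.sum_comm]
    _ = ∑ i, ∑ t, ∑ j, ∑ s, a j s * b t i * η s t (y i j) := by
        refine Finset.sum_congr rfl fun i _ => ?_
        rw [Finset.sum_comm]
    _ = ∑ t, ∑ i, ∑ s, ∑ j, a j s * b t i * η s t (y i j) := by
        rw [Finset.sum_comm]
        refine Finset.sum_congr rfl fun t _ => Finset.sum_congr rfl fun i _ => ?_
        rw [Finset.sum_comm]
    _ = _ := by
        refine Finset.sum_congr rfl fun t _ => ?_
        rw [Finset.sum_comm]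
        refine Finset.sum_congr rfl fun s _ => Finset.sum_congr rfl fun i _ =>
          Finset.sum_congr rfl fun j _ => ?_
        ring

/-- The pairing becomes a scalar bilinear form on vectorized matrices. The transpose on `ζ` is the
reason why the opposite of the dual operator space appears. -/
theorem pairing_biMul_right {m n : ℕ} (ζ : Matrix (Fin n) (Fin n) (StrongDual ℂ F))
    (X : Matrix (Fin n) (Fin m) ℂ) (z : Matrix (Fin m) (Fin m) F) (Y : Matrix (Fin m) (Fin n) ℂ) :
    pairing ζ (biMul X z Y) = (fun a : Fin n × Fin m => X a.1 a.2) ⬝ᵥ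
      (OperatorSpace.amplify ζᵀ z *ᵥ fun b : Fin n × Fin m => Y b.2 b.1) := by
  simp only [pairing, biMul, dotProduct, Matrix.mulVec, OperatorSpace.amplify, Matrix.of_apply,
    Matrix.transpose_apply, Fintype.sum_prod_type, map_sum, map_smul, smul_eq_mul, Finset.mul_sum]
  refine Finset.sum_congr rfl fun i _ => ?_
  rw [Finset.sum_comm]
  refine Finset.sum_congr rfl fun u _ => Finset.sum_congr rfl fun j _ =>
    Finset.sum_congr rfl fun v _ => ?_
  ring

/-- Cauchy-Schwarz in additive form, which matches the sum of two traces used with `Fac`. -/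
theorem norm_dotProduct_mulVec_le {m n : Type*} [Fintype m] [Fintype n] [DecidableEq n]
    {M : Matrix m n ℂ} (hM : ‖M‖ ≤ 1) (x : m → ℂ) (w : n → ℂ) :
    ‖x ⬝ᵥ (M *ᵥ w)‖ ≤ (∑ i, ‖x i‖ ^ 2 + ∑ j, ‖w j‖ ^ 2) / 2 := by
  have h1 := sq_le_of_norm M w
  have h2 : ‖M‖ ^ 2 * ∑ j, ‖w j‖ ^ 2 ≤ 1 * ∑ j, ‖w j‖ ^ 2 :=
    mul_le_mul_of_nonneg_right (pow_le_one₀ (norm_nonneg _) hM)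
      (Finset.sum_nonneg fun _ _ => by positivity)
  have h3 : ‖x ⬝ᵥ (M *ᵥ w)‖ ≤ ∑ i, (‖x i‖ ^ 2 + ‖(M *ᵥ w) i‖ ^ 2) / 2 := by
    refine (norm_sum_le _ _).trans (Finset.sum_le_sum fun i _ => ?_)
    rw [norm_mul]
    nlinarith [sq_nonneg (‖x i‖ - ‖(M *ᵥ w) i‖)]
  rw [← Finset.sum_div, Finset.sum_add_distrib] at h3
  linarith

/-- Both sides are the squared Hilbert-Schmidt norm of `b c`: the pairing of `c c*` with `b* b`
measures the merged outer factor. -/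
theorem trace_mul_conjTranspose_mul_conjTranspose_mul {l m n : Type*} [Fintype l] [Fintype m]
    [Fintype n] (c : Matrix m n ℂ) (b : Matrix l m ℂ) :
    (c * cᴴ * (bᴴ * b)).trace = ((b * c)ᴴ * (b * c)).trace := by
  rw [conjTranspose_mul, Matrix.mul_assoc, Matrix.trace_mul_comm]
  simp only [Matrix.mul_assoc]

theorem trace_conjTranspose_mul_mul_conjTranspose {l m n : Type*} [Fintype l] [Fintype m]
    [Fintype n] (d : Matrix l m ℂ) (a : Matrix m n ℂ) :
    (dᴴ * d * (a * aᴴ)).trace = ((d * a)ᴴ * (d * a)).trace := by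
  rw [conjTranspose_mul, ← Matrix.mul_assoc, Matrix.trace_mul_comm]
  simp only [Matrix.mul_assoc]

variable {S : OperatorSpace F} {k : ℕ} {N₁ N₁' N₂ N₂' : Matrix (Fin k) (Fin k) ℂ → ℝ}

theorem Fac.norm_pairing_le {P R P' R' : Matrix (Fin k) (Fin k) ℂ}
    {y : Matrix (Fin k) (Fin k) F} {η : Matrix (Fin k) (Fin k) (StrongDual ℂ F)}
    (h : Fac S P R y) (h' : Fac S.dual.op P' R' η) :
    ‖pairing η y‖ ≤ ((P * R').trace.re + (R * P').trace.re) / 2 := by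
  obtain ⟨m, c, z, d, hz, rfl, rfl, rfl⟩ := h
  obtain ⟨n, a, ζ, b, hζ, rfl, rfl, rfl⟩ := h'
  have hM : ‖OperatorSpace.amplify ζᵀ z‖ ≤ 1 :=
    (S.norm_amplify_le_of_le_one ζᵀ z hz).trans hζ
  rw [pairing_biMul_left, biMul_biMul, pairing_biMul_right]
  refine (norm_dotProduct_mulVec_le hM _ _).trans_eq ?_
  rw [trace_mul_conjTranspose_mul_conjTranspose_mul, trace_conjTranspose_mul_mul_conjTranspose,
    trace_conjTranspose_mul_self_re, trace_conjTranspose_mul_self_re,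
    Fintype.sum_prod_type, Fintype.sum_prod_type_right]

theorem norm_pairing_le (h₁ : DualGauges N₁ N₁') (h₂ : DualGauges N₂ N₂')
    (η : Matrix (Fin k) (Fin k) (StrongDual ℂ F)) (y : Matrix (Fin k) (Fin k) F) :
    ‖pairing η y‖ ≤ facNorm S.dual.op N₂' N₁' η * facNorm S N₁ N₂ y := by
  refine le_mul_of_forall_lt₀ fun r' hr' r hr => ?_
  have hr'0 := (facNorm_nonneg _ _ _ _).trans_lt hr'
  have hr0 := (facNorm_nonneg _ _ _ _).trans_lt hr
  obtain ⟨P, R, hf, hP, hR⟩ := exists_fac_of_facNorm_lt h₁ h₂ hr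
  obtain ⟨P', R', hf', hP', hR'⟩ := exists_fac_of_facNorm_lt h₂.symm h₁.symm hr'
  refine (hf.norm_pairing_le hf').trans ?_
  have e1 : (P * R').trace.re ≤ r * r' :=
    (h₁.holder _ _ hf.posSemidef_left hf'.posSemidef_right).trans
      (mul_le_mul hP hR' (h₁.symm.nonneg hf'.posSemidef_right) hr0.le)
  have e2 : (R * P').trace.re ≤ r * r' :=
    (h₂.holder _ _ hf.posSemidef_right hf'.posSemidef_left).trans
      (mul_le_mul hR hP' (h₂.symm.nonneg hf'.posSemidef_left) hr0.le)
  linarith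

/-- A functional which is bounded for the norm `facNorm S N₁ N₂` is dominated by a pair of positive
functionals in the dual unit balls. -/
theorem exists_dominating_of_pairing_le (h₁ : DualGauges N₁ N₁') (h₂ : DualGauges N₂ N₂')
    {η : Matrix (Fin k) (Fin k) (StrongDual ℂ F)}
    (hη : ∀ y, (pairing η y).re ≤ facNorm S N₁ N₂ y) :
    ∃ f g : Matrix (Fin k) (Fin k) ℂ, f.PosSemidef ∧ N₁' f ≤ 1 ∧ g.PosSemidef ∧ N₂' g ≤ 1 ∧
      ∀ P R y, Fac S P R y → (pairing η y).re ≤ ((P * f).trace.re + (R * g).trace.re) / 2 := by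
  -- The minimax family is indexed by all factorizations of all `y`; each gives a function affine in
  -- `(f, g)`.
  let ι := {t : Matrix (Fin k) (Fin k) ℂ × Matrix (Fin k) (Fin k) ℂ × Matrix (Fin k) (Fin k) F //
    Fac S t.1 t.2.1 t.2.2}
  have hcont : ∀ P : Matrix (Fin k) (Fin k) ℂ,
      Continuous fun f : Matrix (Fin k) (Fin k) ℂ => (P * f).trace.re := fun P =>
    Complex.continuous_re.comp ((continuous_const.mul continuous_id).matrix_trace)
  have haff : ∀ (P f f' : Matrix (Fin k) (Fin k) ℂ) (a b : ℝ), (P * (a • f + b • f')).trace.re =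
      a * (P * f).trace.re + b * (P * f').trace.re := by
    intro P f f' a b
    simp [Matrix.mul_add, Matrix.trace_add, Matrix.trace_smul]
  obtain ⟨⟨f, g⟩, ⟨⟨hf, hf1⟩, hg, hg1⟩, hfg⟩ := exists_forall_nonneg_of_affine
    (h₁.symm.isCompact_ball.prod h₂.symm.isCompact_ball)
    (h₁.symm.convex_ball.prod h₂.symm.convex_ball)
    (fun (i : ι) (v : Matrix (Fin k) (Fin k) ℂ × Matrix (Fin k) (Fin k) ℂ) =>
      ((i.1.1 * v.1).trace.re + (i.1.2.1 * v.2).trace.re) / 2 - (pairing η i.1.2.2).re)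
    (fun i => (((hcont _).comp continuous_fst).add ((hcont _).comp continuous_snd)).div_const 2
      |>.sub continuous_const)
    (fun i v v' a b hab => by
      simp only [Prod.fst_add, Prod.snd_add, Prod.smul_fst, Prod.smul_snd, haff]
      linear_combination (pairing η i.1.2.2).re * hab)
    (fun s w hw => by
      -- A nonnegative combination of factorizations is again a factorization. The `f` and `g`
      -- attaining the gauges of its `P` and `R` make the combined function nonnegative, by the
      -- bound on `η`.
      have hfac := Fac.sum s (fun i : ι => w i • i.1.1) (fun i => w i • i.1.2.1)
        (fun i => (w i : ℂ) • i.1.2.2) fun i => i.2.smul (hw i)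
      obtain ⟨f, hf, hf1, hf2⟩ := h₁.attain _ hfac.posSemidef_left
      obtain ⟨g, hg, hg1, hg2⟩ := h₂.attain _ hfac.posSemidef_right
      refine ⟨(f, g), ⟨⟨hf, hf1⟩, hg, hg1⟩, ?_⟩
      have h3 := (hη _).trans (hfac.facNorm_le h₁ h₂)
      rw [← hf2, ← hg2, pairing_sum_right, Matrix.sum_mul, Matrix.sum_mul, Matrix.trace_sum,
        Matrix.trace_sum, Complex.re_sum, Complex.re_sum, Complex.re_sum,
        ← Finset.sum_add_distrib, Finset.sum_div, ← sub_nonneg, ← Finset.sum_sub_distrib] at h3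
      refine h3.trans_eq (Finset.sum_congr rfl fun i _ => ?_)
      rw [pairing_smul_right, Complex.re_ofReal_mul, Matrix.smul_mul, Matrix.smul_mul,
        Matrix.trace_smul, Matrix.trace_smul, Complex.smul_re, Complex.smul_re, smul_eq_mul,
        smul_eq_mul]
      ring)
  refine ⟨f, g, hf, hf1, hg, hg1, fun P R y h => ?_⟩
  exact sub_nonneg.1 (hfg ⟨(P, R, y), h⟩)

/-- The dominating pair `f`, `g` provides the outer factors of `η`; the domination itself is the
contractivity of the inner factor. -/
theorem facNorm_dual_le_one (h₁ : DualGauges N₁ N₁') (h₂ : DualGauges N₂ N₂')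
    {η : Matrix (Fin k) (Fin k) (StrongDual ℂ F)}
    (hη : ∀ y, (pairing η y).re ≤ facNorm S N₁ N₂ y) : facNorm S.dual.op N₂' N₁' η ≤ 1 := by
  obtain ⟨f, g, hf, hf1, hg, hg1, hdom⟩ := exists_dominating_of_pairing_le h₁ h₂ hη
  have hone : (1 : Matrix (Fin k) (Fin k) ℂ).PosSemidef := PosSemidef.one
  have key : ∀ ε : ℝ, 0 < ε →
      facNorm S.dual.op N₂' N₁' η ≤ 1 + ε * ((N₁' 1 + N₂' 1) / 2) := by
    intro ε hε
    have hε1 : (ε • (1 : Matrix (Fin k) (Fin k) ℂ)).PosSemidef := posSemidef_real_smul hone hε.le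
    obtain ⟨B, hB⟩ := exists_conjTranspose_mul_self_eq (hf.add hε1)
    obtain ⟨A₀, hA₀⟩ := exists_conjTranspose_mul_self_eq (hg.add hε1)
    have hBu := isUnit_det_of_conjTranspose_mul_self_eq hf hε hB
    -- `A` is to be the left factor of `η`, so its gauge is taken at `A * Aᴴ`.
    obtain ⟨A, rfl⟩ : ∃ A, A₀ = Aᴴ := ⟨A₀ᴴ, (conjTranspose_conjTranspose _).symm⟩
    have hAu : IsUnit A.det := by
      have := isUnit_det_of_conjTranspose_mul_self_eq hg hε hA₀
      rw [det_conjTranspose] at this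
      exact isUnit_star.1 this
    rw [conjTranspose_conjTranspose] at hA₀
    have hNB : N₁' (Bᴴ * B) ≤ 1 + ε * N₁' 1 := by
      rw [hB]
      exact (h₁.symm.add_le hf hε1).trans (add_le_add hf1 (h₁.symm.smul_le hone hε.le))
    have hNA : N₂' (A * Aᴴ) ≤ 1 + ε * N₂' 1 := by
      rw [hA₀]
      exact (h₂.symm.add_le hg hε1).trans (add_le_add hg1 (h₂.symm.smul_le hone hε.le))
    have hle : ∀ {f P : Matrix (Fin k) (Fin k) ℂ}, P.PosSemidef →
        (P * f).trace.re ≤ (P * (f + ε • 1)).trace.re := by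
      intro f P hP
      rw [Matrix.mul_add, Matrix.trace_add, Complex.add_re]
      exact le_add_of_nonneg_right (trace_mul_re_nonneg hP hε1)
    set ζ := biMul A⁻¹ η B⁻¹ with hζ
    have hηζ : η = biMul A ζ B := by
      rw [hζ, biMul_biMul, mul_nonsing_inv _ hAu, nonsing_inv_mul _ hBu, one_biMul_one]
    have hζ1 : S.dual.op.matNorm k ζ ≤ 1 := by
      refine S.dualMatNorm_le fun m z hz => norm_le_of_sq _ zero_le_one fun v => ?_
      set u := OperatorSpace.amplify ζᵀ z *ᵥ v with hu
      -- `X` and `Y` are the vectors `ū` and `v` reshaped, so that the pairing of `ζ` with `X z Y`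
      -- equals `‖u‖²`.
      set X : Matrix (Fin k) (Fin m) ℂ := Matrix.of fun i s => star (u (i, s)) with hX
      set Y : Matrix (Fin m) (Fin k) ℂ := Matrix.of fun s i => v (i, s) with hY
      have h3 : pairing ζ (biMul X z Y) = star u ⬝ᵥ u := pairing_biMul_right ζ X z Y
      rw [hζ, pairing_biMul_left, biMul_biMul] at h3
      set c := B⁻¹ * X with hc
      set d := Y * A⁻¹ with hd
      have h4 := hdom _ _ _ ⟨m, c, z, d, hz, rfl, rfl, rfl⟩
      have h5 := hle (f := f) (posSemidef_self_mul_conjTranspose c)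
      have h6 := hle (f := g) (posSemidef_conjTranspose_mul_self d)
      have e1 : B * c = X := mul_nonsing_inv_cancel_left _ _ hBu
      have e2 : d * A = Y := nonsing_inv_mul_cancel_right _ _ hAu
      rw [← hB, trace_mul_conjTranspose_mul_conjTranspose_mul, e1,
        trace_conjTranspose_mul_self_re] at h5
      rw [← hA₀, trace_conjTranspose_mul_mul_conjTranspose, e2,
        trace_conjTranspose_mul_self_re, Finset.sum_comm] at h6
      rw [h3, ← sum_norm_sq_eq] at h4
      simp only [hX, hY, Matrix.of_apply, norm_star] at h5 h6
      rw [← Fintype.sum_prod_type'] at h5 h6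
      -- The domination now reads `‖u‖² ≤ (‖u‖² + ‖v‖²) / 2`, that is `‖u‖ ≤ ‖v‖`.
      rw [one_pow, one_mul]
      linarith
    rw [hηζ]
    refine (facNorm_biMul_le _ _ _ _ _ _).trans ?_
    have h3 : √(N₂' (A * Aᴴ)) * S.dual.op.matNorm k ζ * √(N₁' (Bᴴ * B)) ≤
        √(N₂' (A * Aᴴ)) * 1 * √(N₁' (Bᴴ * B)) := by gcongr
    have h4 := Real.sq_sqrt (h₁.symm.nonneg (posSemidef_conjTranspose_mul_self B))
    have h5 := Real.sq_sqrt (h₂.symm.nonneg (posSemidef_self_mul_conjTranspose A))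
    nlinarith [sq_nonneg (√(N₁' (Bᴴ * B)) - √(N₂' (A * Aᴴ)))]
  refine le_of_forall_pos_le_add fun δ hδ => ?_
  have h10 : 0 ≤ (N₁' 1 + N₂' 1) / 2 :=
    div_nonneg (add_nonneg (h₁.symm.nonneg hone) (h₂.symm.nonneg hone)) zero_le_two
  refine (key (δ / ((N₁' 1 + N₂' 1) / 2 + 1)) (by positivity)).trans ?_
  gcongr
  rw [div_mul_eq_mul_div, div_le_iff₀ (by positivity)]
  nlinarith

theorem facNorm_dual_le (h₁ : DualGauges N₁ N₁') (h₂ : DualGauges N₂ N₂')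
    {η : Matrix (Fin k) (Fin k) (StrongDual ℂ F)} {C : ℝ} (hC : 0 ≤ C)
    (hη : ∀ y, ‖pairing η y‖ ≤ C * facNorm S N₁ N₂ y) : facNorm S.dual.op N₂' N₁' η ≤ C := by
  -- Dividing by `r > C` instead of `C` covers `C = 0`.
  refine le_of_forall_gt_imp_ge_of_dense fun r hr => ?_
  have hr0 : 0 < r := hC.trans_lt hr
  have h := facNorm_dual_le_one (S := S) h₁ h₂ (η := ((r : ℂ)⁻¹) • η) fun y => by
    refine (Complex.re_le_norm _).trans ?_
    rw [pairing_smul_left, norm_mul, norm_inv, Complex.norm_real, Real.norm_of_nonneg hr0.le,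
      inv_mul_le_iff₀ hr0]
    exact (hη y).trans (mul_le_mul_of_nonneg_right hr.le (facNorm_nonneg _ _ _ _))
  rwa [facNorm_smul, norm_inv, Complex.norm_real, Real.norm_of_nonneg hr0.le,
    inv_mul_le_iff₀ hr0, mul_one] at h

theorem isNorm_facNorm (S : OperatorSpace F) (h₁ : DualGauges N₁ N₁') (h₂ : DualGauges N₂ N₂') :
    IsNorm (facNorm S N₁ N₂) where
  add_le := facNorm_add_le h₁ h₂
  smul := facNorm_smul S N₁ N₂
  eq_zero y hy := by
    ext i j
    -- Pairing with matrices having a single nonzero entry detects every `ξ (y i j)`, and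
    -- functionals separate the points of `F`.
    refine SeparatingDual.eq_zero_of_forall_dual_eq_zero (R := ℂ) fun ξ => ?_
    have h := norm_pairing_le (S := S) h₁ h₂ (Matrix.single j i ξ) y
    rwa [hy, mul_zero, norm_le_zero_iff, pairing_single_left] at h

end pairing

/-! ### The dual Banach space -/

section dual

variable {F : Type*} [NormedAddCommGroup F] [NormedSpace ℂ F] {S : OperatorSpace F} {k : ℕ}
  {N₁ N₁' N₂ N₂' : Matrix (Fin k) (Fin k) ℂ → ℝ}

theorem norm_banachBy_of {E : Type*} [AddCommGroup E] [Module ℂ E] {ν : E → ℝ} (h : IsNorm ν)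
    (x : E) : ‖BanachBy.of h x‖ = ν x :=
  UniformSpace.Completion.norm_coe (E := NormedBy h) x

/-- The canonical map into the completion, as a linear map. -/
noncomputable def ofLinear {E : Type*} [AddCommGroup E] [Module ℂ E] {ν : E → ℝ} (h : IsNorm ν) :
    E →ₗ[ℂ] BanachBy h where
  toFun := BanachBy.of h
  map_add' x y := UniformSpace.Completion.coe_add (α := NormedBy h) x y
  map_smul' t x := UniformSpace.Completion.coe_smul (X := NormedBy h) t x

theorem denseRange_ofLinear {E : Type*} [AddCommGroup E] [Module ℂ E] {ν : E → ℝ} (h : IsNorm ν) :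
    DenseRange (ofLinear h) :=
  UniformSpace.Completion.denseRange_coe (α := NormedBy h)

/-- A single entry is a column times a `1 × 1` matrix times a row. The bound makes the entries of a
represented functional continuous on `F`. -/
theorem matNorm_single_le (S : OperatorSpace F) (i j : Fin k) :
    ∃ C : ℝ, ∀ x : F, S.matNorm k (Matrix.single i j x) ≤ C * ‖x‖ := by
  refine ⟨‖(Matrix.of fun s (_ : Fin 1) => if s = i then (1 : ℂ) else 0)‖ *
    ‖(Matrix.of fun (_ : Fin 1) t => if t = j then (1 : ℂ) else 0)‖, fun x => ?_⟩
  have h := S.matNorm_biMul_le k 1 (Matrix.of fun s (_ : Fin 1) => if s = i then (1 : ℂ) else 0)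
    (Matrix.of fun _ _ => x) (Matrix.of fun (_ : Fin 1) t => if t = j then (1 : ℂ) else 0)
  rw [S.matNorm_one] at h
  have e : biMul (Matrix.of fun s (_ : Fin 1) => if s = i then (1 : ℂ) else 0)
      (Matrix.of fun _ _ => x) (Matrix.of fun (_ : Fin 1) t => if t = j then (1 : ℂ) else 0) =
      Matrix.single i j x := by
    ext s t
    simp only [biMul, Matrix.single_apply, Matrix.of_apply, Finset.univ_unique, Finset.sum_const,
      Finset.card_singleton, one_smul, ite_mul, one_mul, zero_mul, ite_smul, zero_smul, ite_and,
      eq_comm]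
  rw [e] at h
  linarith

/-- The matrix over `F*` which represents a functional on the completion of `M_k(F)`. -/
noncomputable def coordFunctional (hF : IsNorm (facNorm S N₁ N₂)) (i j : Fin k)
    (φ : StrongDual ℂ (BanachBy hF)) : StrongDual ℂ F :=
  LinearMap.mkContinuousOfExistsBound
    (φ.toLinearMap ∘ₗ ofLinear hF ∘ₗ Matrix.singleLinearMap ℂ i j) (by
      obtain ⟨C, hC⟩ := matNorm_single_le S i j
      refine ⟨‖φ‖ * (√(N₁ 1) * C * √(N₂ 1)), fun x => ?_⟩
      refine (φ.le_opNorm _).trans ?_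
      rw [mul_assoc]
      refine mul_le_mul_of_nonneg_left ?_ (norm_nonneg _)
      refine (norm_banachBy_of hF _).trans_le ((facNorm_le_matNorm S N₁ N₂ _).trans ?_)
      calc _ ≤ √(N₁ 1) * (C * ‖x‖) * √(N₂ 1) := by gcongr; exact hC x
        _ = _ := by ring)

theorem coordFunctional_apply (hF : IsNorm (facNorm S N₁ N₂)) (i j : Fin k)
    (φ : StrongDual ℂ (BanachBy hF)) (x : F) :
    coordFunctional hF i j φ x = φ (BanachBy.of hF (Matrix.single i j x)) := rfl

/-- The representation of functionals on the completion of `M_k(F)` by matrices over `F*`. -/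
noncomputable def dualCoord (hF : IsNorm (facNorm S N₁ N₂)) :
    StrongDual ℂ (BanachBy hF) →ₗ[ℂ] Matrix (Fin k) (Fin k) (StrongDual ℂ F) where
  toFun φ := Matrix.of fun j i => coordFunctional hF i j φ
  map_add' φ ψ := by
    ext j i x
    simp [coordFunctional_apply]
  map_smul' t φ := by
    ext j i x
    simp [coordFunctional_apply]

theorem pairing_dualCoord (hF : IsNorm (facNorm S N₁ N₂)) (φ : StrongDual ℂ (BanachBy hF))
    (y : Matrix (Fin k) (Fin k) F) : pairing (dualCoord hF φ) y = φ (BanachBy.of hF y) := by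
  have h : φ (ofLinear hF y) = ∑ i, ∑ j, φ (ofLinear hF (Matrix.single i j (y i j))) := by
    conv_lhs => rw [Matrix.matrix_eq_sum_single y]
    simp only [map_sum]
  exact h.symm

/-- One inequality is the minimax half of the duality; the other is the pairing bound on `M_k(F)`,
carried to the completion by density. -/
theorem facNorm_dualCoord (h₁ : DualGauges N₁ N₁') (h₂ : DualGauges N₂ N₂')
    (hF : IsNorm (facNorm S N₁ N₂)) (φ : StrongDual ℂ (BanachBy hF)) :
    facNorm S.dual.op N₂' N₁' (dualCoord hF φ) = ‖φ‖ := by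
  refine le_antisymm (facNorm_dual_le h₁ h₂ (norm_nonneg _) fun y => ?_) ?_
  · rw [pairing_dualCoord]
    exact (φ.le_opNorm _).trans_eq (by rw [norm_banachBy_of])
  · refine φ.opNorm_le_bound (facNorm_nonneg _ _ _ _) fun x => ?_
    refine (denseRange_ofLinear hF).induction_on
      (p := fun x => ‖φ x‖ ≤ facNorm S.dual.op N₂' N₁' (dualCoord hF φ) * ‖x‖) x ?_ fun y => ?_
    · exact isClosed_le φ.continuous.norm (continuous_const.mul continuous_norm)
    · have h := norm_pairing_le (S := S) h₁ h₂ (dualCoord hF φ) y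
      rw [pairing_dualCoord] at h
      exact h.trans_eq (by rw [← norm_banachBy_of hF]; rfl)

/-- By the pairing bound, every matrix over `F*` defines a bounded functional, which extends to the
completion. -/
theorem dualCoord_surjective (h₁ : DualGauges N₁ N₁') (h₂ : DualGauges N₂ N₂')
    (hF : IsNorm (facNorm S N₁ N₂)) : Function.Surjective (dualCoord hF) := by
  intro η
  let p : Matrix (Fin k) (Fin k) F →ₗ[ℂ] ℂ :=
    { toFun := pairing η
      map_add' := pairing_add_right η
      map_smul' := pairing_smul_right η }
  have hp : ∃ C, ∀ y, ‖p y‖ ≤ C * ‖ofLinear hF y‖ :=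
    ⟨_, fun y => (norm_pairing_le (S := S) h₁ h₂ η y).trans_eq
      (by rw [← norm_banachBy_of hF]; rfl)⟩
  refine ⟨p.extendOfNorm (ofLinear hF), ?_⟩
  ext j i x
  refine (LinearMap.extendOfNorm_eq (denseRange_ofLinear hF) hp _).trans ?_
  exact pairing_single_right η i j x

/-- The dual of the completion of `M_k(F)` for `facNorm S N₁ N₂` is the completion of `M_k(F*)` for
the norm given by the opposite of the dual operator space and the dual gauges. -/
theorem exists_dual_isometry (S : OperatorSpace F) (h₁ : DualGauges N₁ N₁')
    (h₂ : DualGauges N₂ N₂') :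
    ∃ (hF : IsNorm (facNorm S N₁ N₂)) (hG : IsNorm (facNorm S.dual.op N₂' N₁'))
      (Φ : BanachBy hG ≃ₗᵢ[ℂ] StrongDual ℂ (BanachBy hF)),
      ∀ (a c : Matrix (Fin k) (Fin k) ℂ) (x : F) (η : StrongDual ℂ F),
        Φ (BanachBy.of hG (tmul c η)) (BanachBy.of hF (tmul a x)) = (a * c).trace * η x := by
  have hF := isNorm_facNorm S h₁ h₂
  have hG := isNorm_facNorm S.dual.op h₂.symm h₁.symm
  have hinj : Function.Injective (dualCoord hF) := by
    refine (injective_iff_map_eq_zero _).2 fun φ hφ => ?_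
    have h := facNorm_dualCoord h₁ h₂ hF φ
    rw [hφ, ← norm_banachBy_of hG, show BanachBy.of hG 0 = 0 from (ofLinear hG).map_zero,
      norm_zero] at h
    exact norm_eq_zero.1 h.symm
  let e := (LinearEquiv.ofBijective (dualCoord hF) ⟨hinj, dualCoord_surjective h₁ h₂ hF⟩).symm
  have he : ∀ η, dualCoord hF (e η) = η := fun η =>
    LinearEquiv.apply_symm_apply
      (LinearEquiv.ofBijective (dualCoord hF) ⟨hinj, dualCoord_surjective h₁ h₂ hF⟩) η
  have hnorm : ∀ η, ‖(LinearMap.id : _ →ₗ[ℂ] StrongDual ℂ (BanachBy hF)) (e η)‖ =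
      ‖ofLinear hG η‖ := by
    intro η
    rw [LinearMap.id_apply, ← facNorm_dualCoord h₁ h₂ hF, he]
    exact (norm_banachBy_of hG η).symm
  -- The inverse of `dualCoord` is isometric from `M_k(F*)` onto a complete space, so it extends to
  -- the completion.
  refine ⟨hF, hG, e.extendOfIsometry (ofLinear hG) LinearMap.id (denseRange_ofLinear hG)
    Function.surjective_id.denseRange hnorm, fun a c x η => ?_⟩
  have h := LinearEquiv.extendOfIsometry_eq e (ofLinear hG) LinearMap.id (denseRange_ofLinear hG)
    Function.surjective_id.denseRange hnorm (tmul c η)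
  refine (congrArg (fun φ : StrongDual ℂ (BanachBy hF) => φ (BanachBy.of hF (tmul a x))) h).trans ?_
  rw [LinearMap.id_apply, ← pairing_dualCoord, he, pairing_tmul]

end dual

/-! ### The Schatten norms -/

section schatten

variable {F : Type*} [NormedAddCommGroup F] [NormedSpace ℂ F] {k : ℕ}

theorem alphaL_of_two_le (S : OperatorSpace F) {p : ℝ} (hp : 2 ≤ p) :
    S.alphaL p k =
      facNorm S (spectralGauge fun v => ‖v‖) (spectralGauge (lpGauge (p / 2))) := by
  ext y
  simp only [OperatorSpace.alphaL, if_pos hp, facNorm, sqrt_spectralGauge_norm_mul_conjTranspose,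
    sqrt_spectralGauge_lp_conjTranspose_mul (by linarith : 0 < p)]

theorem alphaR_of_two_le (S : OperatorSpace F) {p : ℝ} (hp : 2 ≤ p) :
    S.alphaR p k =
      facNorm S (spectralGauge (lpGauge (p / 2))) (spectralGauge fun v => ‖v‖) := by
  ext y
  simp only [OperatorSpace.alphaR, if_pos hp, facNorm, sqrt_spectralGauge_norm_conjTranspose_mul,
    sqrt_spectralGauge_lp_mul_conjTranspose (by linarith : 0 < p)]

theorem alphaL_of_lt_two (S : OperatorSpace F) {p : ℝ} (hp : 1 < p) (hp2 : p < 2) :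
    S.alphaL p k = facNorm S (spectralGauge (lpGauge (1 / (1 / p - 1 / 2) / 2)))
      (spectralGauge (lpGauge 1)) := by
  have hq : 0 < 1 / (1 / p - 1 / 2) :=
    one_div_pos.2 (sub_pos.2 (one_div_lt_one_div_of_lt (by linarith) hp2))
  ext y
  have h2 := fun b : Matrix (Fin k) (Fin k) ℂ => sqrt_spectralGauge_lp_conjTranspose_mul two_pos b
  rw [div_self two_ne_zero] at h2
  simp only [OperatorSpace.alphaL, if_neg hp2.not_ge, facNorm, h2,
    sqrt_spectralGauge_lp_mul_conjTranspose hq]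

theorem alphaR_of_lt_two (S : OperatorSpace F) {p : ℝ} (hp : 1 < p) (hp2 : p < 2) :
    S.alphaR p k = facNorm S (spectralGauge (lpGauge 1))
      (spectralGauge (lpGauge (1 / (1 / p - 1 / 2) / 2))) := by
  have hq : 0 < 1 / (1 / p - 1 / 2) :=
    one_div_pos.2 (sub_pos.2 (one_div_lt_one_div_of_lt (by linarith) hp2))
  ext y
  have h2 := fun b : Matrix (Fin k) (Fin k) ℂ => sqrt_spectralGauge_lp_mul_conjTranspose two_pos b
  rw [div_self two_ne_zero] at h2
  simp only [OperatorSpace.alphaR, if_neg hp2.not_ge, facNorm, h2,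
    sqrt_spectralGauge_lp_conjTranspose_mul hq]

/-- With `1/q = 1/p - 1/2`, one has `2/q + 2/p' = 2(1/p + 1/p') - 1 = 1`, and `q/2 > 1` because `p >
1`. -/
theorem holderConjugate_half {p p' : ℝ} (hp : 1 < p) (hp2 : p < 2) (hpp' : 1 / p + 1 / p' = 1) :
    (1 / (1 / p - 1 / 2) / 2).HolderConjugate (p' / 2) := by
  have h1 : 0 < 1 / p - 1 / 2 := sub_pos.2 (one_div_lt_one_div_of_lt (by linarith) hp2)
  have h2 : 1 / p < 1 := (div_lt_one (by linarith)).2 hp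
  rw [Real.holderConjugate_iff]
  constructor
  · rw [div_div, lt_div_iff₀ (by linarith)]
    linarith
  · have e1 : (1 / (1 / p - 1 / 2) / 2)⁻¹ = 2 * (1 / p - 1 / 2) := by field_simp
    have e2 : (p' / 2)⁻¹ = 2 * (1 / p') := by rw [inv_div]; ring
    rw [e1, e2]
    linarith

theorem two_lt_of_lt_two {p p' : ℝ} (hp : 1 < p) (hp' : 1 < p') (hpp' : 1 / p + 1 / p' = 1)
    (hp2 : p < 2) : 2 < p' := by
  have h1 : 1 / 2 < 1 / p := one_div_lt_one_div_of_lt (by linarith) hp2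
  have h2 : 1 / p' < 1 / 2 := by linarith
  exact (one_div_lt_one_div (by linarith) two_pos).1 h2

end schatten

end OpSp

theorem proposition3p1 {F : Type*} [NormedAddCommGroup F] [NormedSpace ℂ F]
    (S : OpSp.OperatorSpace F) (k : ℕ) (p p' : ℝ) (hp : 1 < p) (hp' : 1 < p')
    (hpp' : 1 / p + 1 / p' = 1) :
    (∃ (hF : OpSp.IsNorm (S.alphaL p k)) (hG : OpSp.IsNorm (S.dual.op.alphaL p' k))
      (Φ : OpSp.BanachBy hG ≃ₗᵢ[ℂ] StrongDual ℂ (OpSp.BanachBy hF)),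
      ∀ (a c : Matrix (Fin k) (Fin k) ℂ) (x : F) (η : StrongDual ℂ F),
        Φ (OpSp.BanachBy.of hG (OpSp.tmul c η)) (OpSp.BanachBy.of hF (OpSp.tmul a x)) =
          (a * c).trace * η x) ∧
    (∃ (hF : OpSp.IsNorm (S.alphaR p k)) (hG : OpSp.IsNorm (S.dual.op.alphaR p' k))
      (Φ : OpSp.BanachBy hG ≃ₗᵢ[ℂ] StrongDual ℂ (OpSp.BanachBy hF)),
      ∀ (a c : Matrix (Fin k) (Fin k) ℂ) (x : F) (η : StrongDual ℂ F),
        Φ (OpSp.BanachBy.of hG (OpSp.tmul c η)) (OpSp.BanachBy.of hF (OpSp.tmul a x)) =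
          (a * c).trace * η x) := by
  rcases lt_trichotomy p 2 with h | h | h
  · have hc := OpSp.holderConjugate_half hp h hpp'
    have h' := (OpSp.two_lt_of_lt_two hp hp' hpp' h).le
    rw [OpSp.alphaL_of_lt_two S hp h, OpSp.alphaR_of_lt_two S hp h,
      OpSp.alphaL_of_two_le S.dual.op h', OpSp.alphaR_of_two_le S.dual.op h']
    exact ⟨OpSp.exists_dual_isometry S (OpSp.dualGauges_lp hc) OpSp.dualGauges_norm_trace.symm,
      OpSp.exists_dual_isometry S OpSp.dualGauges_norm_trace.symm (OpSp.dualGauges_lp hc)⟩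
  -- At `p = 2` both sides fall in the `p ≥ 2` branch, with the operator norm and the trace as
  -- gauges; dualizing and swapping returns the same pair.
  · obtain rfl : p' = 2 := by
      have h1 : 1 / p' = 1 / 2 := by rw [h] at hpp'; linarith
      simpa using h1
    rw [h, OpSp.alphaL_of_two_le S le_rfl, OpSp.alphaR_of_two_le S le_rfl,
      OpSp.alphaL_of_two_le S.dual.op le_rfl, OpSp.alphaR_of_two_le S.dual.op le_rfl,
      div_self two_ne_zero]
    exact ⟨OpSp.exists_dual_isometry S OpSp.dualGauges_norm_trace OpSp.dualGauges_norm_trace.symm,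
      OpSp.exists_dual_isometry S OpSp.dualGauges_norm_trace.symm OpSp.dualGauges_norm_trace⟩
  · have hpp : 1 / p' + 1 / p = 1 := by linarith
    have h' : p' < 2 := by
      have h1 : 1 / p < 1 / 2 := one_div_lt_one_div_of_lt two_pos h
      have h2 : 1 / 2 < 1 / p' := by linarith
      exact (one_div_lt_one_div two_pos (by linarith)).1 h2
    -- Here `p' < 2`, so `q` is built from `p'` and is conjugate to `p` after halving.
    have hc := (OpSp.holderConjugate_half hp' h' hpp).symm
    rw [OpSp.alphaL_of_two_le S h.le, OpSp.alphaR_of_two_le S h.le,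
      OpSp.alphaL_of_lt_two S.dual.op hp' h', OpSp.alphaR_of_lt_two S.dual.op hp' h']
    exact ⟨OpSp.exists_dual_isometry S OpSp.dualGauges_norm_trace (OpSp.dualGauges_lp hc),
      OpSp.exists_dual_isometry S (OpSp.dualGauges_lp hc) OpSp.dualGauges_norm_trace⟩
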